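/- Graphs are graphs in the sense of Serre. An $X$-labeled graph has its oriented edges labeled by $X\cup X^{-1}$, with $l(\bar e)=l(e)^{-1}$; it is folded if distinct edges with the same initial vertex have distinct labels. For a pointed $X$-labeled graph $\Gamma$ let $\pi_1(\Gamma)\le F_X$ be the subgroup of labels of closed paths at the base point. A core graph is a connected, pointed, folded, labeled graph in which every edge lies on a closed reduced path around the base point. For $H\le F_X$ let $\Gamma_X(H)$ be the core graph, unique up to unique isomorphism, with $\pi_1(\Gamma_X(H))=H$; for $H\le K$ there is a unique morphism $\Gamma_X(H)\to\Gamma_X(K)$ of pointed labeled graphs. Put $\mathrm{Core}(\Gamma)=\Gamma_X(\pi_1(\Gamma))$, a functor on pointed $X$-labeled graphs. A homomorphism $\varphi:F_Y\to F_X$ is non-degenerate if $\varphi(y)\ne 1$ for all $y\in Y$; then $\mathcal F_\varphi$ is the functor from $Y$-labeled to $X$-labeled graphs that replaces every edge labeled $y\in Y$ by a path labeled by the reduced word of $\varphi(y)$. $\mathrm{Trimf}$ forgets the base point of a core graph and deletes its tail (repeatedly removes a vertex of valency one together with its edge); a morphism of core graphs, whose source has at least one edge, is sent to its restriction. A morphism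 of graphs is injective if it is injective on vertices and on edges. **Theorem.** Let $H=\langle b\rangle\le K=\langle b,aba^{-1}\rangle\le F_{\{a,b\}}$, $\Gamma=\Gamma_{\{a,b\}}(H)$ and $\Delta=\Gamma_{\{a,b\}}(K)$. 1. Let $X$ be a countably infinite set. For every non-degenerate homomorphism $\varphi:F_{\{a,b\}}\to F_X$, the morphism of unpointed labeled graphs $\mathrm{Trimf}\circ\mathrm{Core}\circ\mathcal F_\varphi(\Gamma\to\Delta)$ is injective. 2. For every $o\in\mathrm{Out}(F_{\{a,b\}})$ and every automorphism $\theta$ in the class $o$, the morphism of unpointed core graphs $\mathrm{Trimf}\bigl(\Gamma_{\{a,b\}}(\theta(H))\to\Gamma_{\{a,b\}}(\theta(K))\bigr)$ is injective; and for two automorphisms in the class $o$ these morphisms are isomorphic, that is, there are isomorphisms of labeled graphs between their sources and between their targets that make the square commute. 3. For every set $Y$, every injective homomorphism $j:F_{\{a,b\}}\to F_Y$ (for instance the inclusion of a free factor, i.e. a free extension of $F_{\{a,b\}}$) and every automorphism $\theta$ of $F_Y$, the morphism $\mathrm{Trimf}\bigl(\Gamma_Y(\theta j(H))\to\Gamma_Y(\theta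 j(K))\bigr)$ is injective. -/

import Mathlib

universe u v w

namespace CoreGraphs

/-! ## Graphs in the sense of Serre and labeled graphs -/

/-- A graph in the sense of Serre: `ι` is the initial vertex map and `bar` is a fixed-point-free
involution on the set of (oriented) edges. -/
structure Graph where
  V : Type v
  E : Type v
  ι : E → V
  bar : E → E
  bar_ne : ∀ e, bar e ≠ e
  bar_bar : ∀ e, bar (bar e) = e

/-- The formal inverse on `X ∪ X⁻¹`.  The set `X ∪ X⁻¹` is `X × Bool`, with `(x, true)` standing for
`x` and `(x, false)` for `x⁻¹`, as in Mathlib's `FreeGroup`. -/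
def inv {X : Type u} (x : X × Bool) : X × Bool := (x.1, !x.2)

/-- An `X`-labeled graph: a graph with a morphism to the rose `R_X`, which has one vertex and
edge set `X ∪ X⁻¹`.  Such a morphism is a map on edges commuting with the involutions. -/
structure LGraph (X : Type u) extends Graph.{v} where
  label : E → X × Bool
  label_bar : ∀ e, label (bar e) = inv (label e)

/-- A pointed `X`-labeled graph. -/
structure PGraph (X : Type u) extends LGraph.{u, v} X where
  base : V

/-- The terminal vertex of an edge. -/
def Graph.τ (Γ : Graph.{v}) (e : Γ.E) : Γ.V := Γ.ι (Γ.bar e)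

/-- `Γ.IsPath p x y`: the sequence of edges `p` is a path in `Γ` from the vertex `x` to the
vertex `y`. -/
def Graph.IsPath (Γ : Graph.{v}) : List Γ.E → Γ.V → Γ.V → Prop
  | [], x, y => x = y
  | e :: p, x, y => Γ.ι e = x ∧ Γ.IsPath p (Γ.τ e) y

/-- A sequence of edges is reduced if no edge is followed by its inverse. -/
def Graph.IsReduced (Γ : Graph.{v}) (p : List Γ.E) : Prop :=
  List.IsChain (fun e f => f ≠ Γ.bar e) p

/-- The label of a path, an element of the free group. -/
def LGraph.pathLabel {X : Type u} (Γ : LGraph.{u, v} X) (p : List Γ.E) : FreeGroup X :=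
  FreeGroup.mk (p.map Γ.label)

/-- Any two vertices are joined by a path. -/
def Graph.IsConnected (Γ : Graph.{v}) : Prop := ∀ x y : Γ.V, ∃ p, Γ.IsPath p x y

/-- Folded graphs: distinct edges with the same initial vertex have distinct labels. -/
def LGraph.IsFolded {X : Type u} (Γ : LGraph.{u, v} X) : Prop :=
  ∀ e f : Γ.E, Γ.ι e = Γ.ι f → Γ.label e = Γ.label f → e = f

/-- The edge `e` belongs to a closed reduced path around the base point. -/
def PGraph.IsCoreEdge {X : Type u} (Γ : PGraph.{u, v} X) (e : Γ.E) : Prop :=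
  ∃ p, Γ.IsPath p Γ.base Γ.base ∧ Γ.IsReduced p ∧ e ∈ p

/-- A (connected, pointed, folded, labeled) core graph. -/
structure CoreGraph (X : Type u) extends PGraph.{u, v} X where
  folded : toLGraph.IsFolded
  connected : toGraph.IsConnected
  core : ∀ e, toPGraph.IsCoreEdge e

/-! ## Morphisms -/

/-- Morphisms of `X`-labeled graphs. -/
@[ext]
structure LHom {X : Type u} (Γ : LGraph.{u, v} X) (Δ : LGraph.{u, w} X) where
  onV : Γ.V → Δ.V
  onE : Γ.E → Δ.E
  map_ι : ∀ e, Δ.ι (onE e) = onV (Γ.ι e)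
  map_bar : ∀ e, onE (Γ.bar e) = Δ.bar (onE e)
  map_label : ∀ e, Δ.label (onE e) = Γ.label e

/-- Morphisms of pointed `X`-labeled graphs. -/
structure PHom {X : Type u} (Γ : PGraph.{u, v} X) (Δ : PGraph.{u, w} X)
    extends LHom Γ.toLGraph Δ.toLGraph where
  map_base : onV Γ.base = Δ.base

/-- A morphism of graphs is injective if it is injective on vertices and on edges. -/
def LHom.Injective {X : Type u} {Γ : LGraph.{u, v} X} {Δ : LGraph.{u, w} X} (f : LHom Γ Δ) :
    Prop :=
  Function.Injective f.onV ∧ Function.Injective f.onE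

/-- Isomorphisms of labeled graphs: morphisms that are bijective on vertices and on edges. -/
def LHom.Bijective {X : Type u} {Γ : LGraph.{u, v} X} {Δ : LGraph.{u, w} X} (f : LHom Γ Δ) :
    Prop :=
  Function.Bijective f.onV ∧ Function.Bijective f.onE

/-- Composition of morphisms, `g` after `f`. -/
def LHom.comp {X : Type u} {Γ Δ Ξ : LGraph.{u, v} X} (g : LHom Δ Ξ) (f : LHom Γ Δ) :
    LHom Γ Ξ where
  onV x := g.onV (f.onV x)
  onE e := g.onE (f.onE e)
  map_ι e := by rw [g.map_ι, f.map_ι]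
  map_bar e := by rw [f.map_bar, g.map_bar]
  map_label e := by rw [g.map_label, f.map_label]

/-- Two morphisms `f : Γ → Δ` and `f' : Γ' → Δ'` of labeled graphs are isomorphic if there are
isomorphisms `Γ ≅ Γ'` and `Δ ≅ Δ'` that make the square commute. -/
def LHom.IsIsomorphic {X : Type u} {Γ Δ Γ' Δ' : LGraph.{u, v} X} (f : LHom Γ Δ)
    (f' : LHom Γ' Δ') : Prop :=
  ∃ (α : LHom Γ Γ') (β : LHom Δ Δ'), α.Bijective ∧ β.Bijective ∧ β.comp f = f'.comp α

theorem LHom.map_τ {X : Type u} {Γ : LGraph.{u, v} X} {Δ : LGraph.{u, w} X} (f : LHom Γ Δ)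
    (e : Γ.E) : Δ.τ (f.onE e) = f.onV (Γ.τ e) := by
  rw [Graph.τ, ← f.map_bar, f.map_ι]; rfl

theorem LHom.isPath {X : Type u} {Γ : LGraph.{u, v} X} {Δ : LGraph.{u, w} X} (f : LHom Γ Δ)
    {p : List Γ.E} {x y : Γ.V} (h : Γ.IsPath p x y) :
    Δ.IsPath (p.map f.onE) (f.onV x) (f.onV y) := by
  induction p generalizing x with
  | nil => exact congrArg f.onV h
  | cons e p ih =>
    refine ⟨?_, ?_⟩
    · rw [f.map_ι, h.1]
    · rw [f.map_τ]; exact ih h.2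

theorem LHom.pathLabel {X : Type u} {Γ : LGraph.{u, v} X} {Δ : LGraph.{u, w} X} (f : LHom Γ Δ)
    (p : List Γ.E) : Δ.pathLabel (p.map f.onE) = Γ.pathLabel p := by
  simp [LGraph.pathLabel, Function.comp_def, f.map_label]

/-! ## The functor `π₁` -/

theorem Graph.isPath_append {Γ : Graph.{v}} {p q : List Γ.E} {x y z : Γ.V}
    (h : Γ.IsPath p x y) (h' : Γ.IsPath q y z) : Γ.IsPath (p ++ q) x z := by
  induction p generalizing x with
  | nil => cases h; exact h'
  | cons e p ih => exact ⟨h.1, ih h.2⟩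

theorem Graph.isPath_reverse {Γ : Graph.{v}} {p : List Γ.E} {x y : Γ.V}
    (h : Γ.IsPath p x y) : Γ.IsPath (p.map Γ.bar).reverse y x := by
  induction p generalizing x with
  | nil => exact h.symm
  | cons e p ih =>
    simp only [List.map_cons, List.reverse_cons]
    refine Graph.isPath_append (ih h.2) ⟨rfl, ?_⟩
    rw [Graph.τ, Γ.bar_bar]; exact h.1

/-- The subgroup of labels of closed paths at the base point. -/
def PGraph.π₁ {X : Type u} (Γ : PGraph.{u, v} X) : Subgroup (FreeGroup X) where
  carrier := {g | ∃ p, Γ.IsPath p Γ.base Γ.base ∧ Γ.pathLabel p = g}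
  one_mem' := ⟨[], rfl, rfl⟩
  mul_mem' := by
    rintro _ _ ⟨p, hp, rfl⟩ ⟨q, hq, rfl⟩
    exact ⟨p ++ q, Graph.isPath_append hp hq, by simp [LGraph.pathLabel, FreeGroup.mul_mk]⟩
  inv_mem' := by
    rintro _ ⟨p, hp, rfl⟩
    refine ⟨_, Graph.isPath_reverse hp, ?_⟩
    simp only [LGraph.pathLabel, FreeGroup.inv_mk, FreeGroup.invRev, List.map_reverse,
      List.map_map]
    congr 2
    exact List.map_congr_left fun e _ => Γ.label_bar e

theorem PHom.π₁_le {X : Type u} {Γ : PGraph.{u, v} X} {Δ : PGraph.{u, w} X} (f : PHom Γ Δ) :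
    Γ.π₁ ≤ Δ.π₁ := by
  rintro _ ⟨p, hp, rfl⟩
  refine ⟨_, ?_, f.toLHom.pathLabel p⟩
  have := f.toLHom.isPath hp
  rwa [f.map_base] at this

/-! ## The functor `Γ_X` from subgroups of `F_X` to core graphs

`Γ_X(H)` is the core, at the base point, of the pointed covering of the rose `R_X` that belongs
to `H`. -/

/-- Right cosets `H g`. -/
abbrev RCoset {X : Type u} (H : Subgroup (FreeGroup X)) : Type u :=
  Quotient (QuotientGroup.rightRel H)

/-- The coset `H g`. -/
def RCoset.mk {X : Type u} (H : Subgroup (FreeGroup X)) (g : FreeGroup X) : RCoset H :=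
  Quotient.mk _ g

theorem RCoset.mk_eq {X : Type u} {H : Subgroup (FreeGroup X)} {g g' : FreeGroup X} :
    RCoset.mk H g = RCoset.mk H g' ↔ g' * g⁻¹ ∈ H := by
  unfold RCoset.mk
  rw [Quotient.eq, QuotientGroup.rightRel_apply]

/-- Right multiplication of cosets, `(H g) s = H (g s)`. -/
def RCoset.smul {X : Type u} {H : Subgroup (FreeGroup X)} (c : RCoset H) (s : FreeGroup X) :
    RCoset H :=
  Quotient.map' (fun g => g * s) (by
    intro a b h
    rw [QuotientGroup.rightRel_apply] at h ⊢
    simpa [mul_assoc] using h) c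

theorem RCoset.smul_mk {X : Type u} {H : Subgroup (FreeGroup X)} (g s : FreeGroup X) :
    (RCoset.mk H g).smul s = RCoset.mk H (g * s) := rfl

theorem RCoset.smul_smul {X : Type u} {H : Subgroup (FreeGroup X)} (c : RCoset H)
    (s t : FreeGroup X) : (c.smul s).smul t = c.smul (s * t) := by
  induction c using Quotient.inductionOn with
  | _ g => exact congrArg (RCoset.mk H) (mul_assoc g s t)

theorem RCoset.smul_one {X : Type u} {H : Subgroup (FreeGroup X)} (c : RCoset H) :
    c.smul 1 = c := by
  induction c using Quotient.inductionOn with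
  | _ g => exact congrArg (RCoset.mk H) (mul_one g)

/-- The element of the free group given by a letter of `X ∪ X⁻¹`. -/
def letter {X : Type u} (x : X × Bool) : FreeGroup X := FreeGroup.mk [x]

theorem letter_mul_inv {X : Type u} (x : X × Bool) : letter x * letter (inv x) = 1 := by
  have : letter (inv x) = (letter x)⁻¹ := by
    simp [letter, inv, FreeGroup.inv_mk, FreeGroup.invRev]
  rw [this, mul_inv_cancel]

/-- The covering graph of the rose `R_X` that belongs to `H`: its vertices are the cosets `H g`,
and for every `x ∈ X ∪ X⁻¹` it has an edge labeled `x` from `H g` to `H g x`. -/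
def cover {X : Type u} (H : Subgroup (FreeGroup X)) : PGraph.{u, u} X where
  V := RCoset H
  E := RCoset H × (X × Bool)
  ι e := e.1
  bar e := (e.1.smul (letter e.2), inv e.2)
  bar_ne e h := by
    have := congrArg (fun t => t.2.2) h
    simp [inv] at this
  bar_bar e := by
    refine Prod.ext ?_ ?_
    · show (e.1.smul (letter e.2)).smul (letter (inv e.2)) = e.1
      rw [RCoset.smul_smul, letter_mul_inv, RCoset.smul_one]
    · simp [inv]
  label e := e.2
  label_bar _ := rfl
  base := RCoset.mk H 1

/-- The base point and the end points of the core edges. -/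
def PGraph.IsCoreVertex {X : Type u} (Γ : PGraph.{u, v} X) (x : Γ.V) : Prop :=
  x = Γ.base ∨ ∃ e, Γ.IsCoreEdge e ∧ Γ.ι e = x

theorem Graph.isReduced_reverse {Γ : Graph.{v}} {p : List Γ.E} (h : Γ.IsReduced p) :
    Γ.IsReduced (p.map Γ.bar).reverse := by
  unfold Graph.IsReduced at *
  rw [List.isChain_reverse, List.isChain_map]
  refine h.imp ?_
  intro a b hab hba
  rw [Γ.bar_bar] at hba
  exact hab hba.symm

theorem PGraph.IsCoreEdge.bar {X : Type u} {Γ : PGraph.{u, v} X} {e : Γ.E}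
    (h : Γ.IsCoreEdge e) : Γ.IsCoreEdge (Γ.bar e) := by
  obtain ⟨p, hp, hr, he⟩ := h
  exact ⟨_, Graph.isPath_reverse hp, Graph.isReduced_reverse hr,
    by simpa using ⟨e, he, rfl⟩⟩

/-- The pointed labeled graph formed by the core edges and core vertices of `Γ`. -/
def PGraph.corePart {X : Type u} (Γ : PGraph.{u, v} X) : PGraph.{u, v} X where
  V := {x : Γ.V // Γ.IsCoreVertex x}
  E := {e : Γ.E // Γ.IsCoreEdge e}
  ι e := ⟨Γ.ι e.1, Or.inr ⟨e.1, e.2, rfl⟩⟩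
  bar e := ⟨Γ.bar e.1, e.2.bar⟩
  bar_ne e h := Γ.bar_ne e.1 (congrArg Subtype.val h)
  bar_bar e := Subtype.ext (Γ.bar_bar e.1)
  label e := Γ.label e.1
  label_bar e := Γ.label_bar e.1
  base := ⟨Γ.base, Or.inl rfl⟩

/-- The inclusion of the core part. -/
def PGraph.incl {X : Type u} (Γ : PGraph.{u, v} X) : PHom Γ.corePart Γ where
  onV x := x.1
  onE e := e.1
  map_ι _ := rfl
  map_bar _ := rfl
  map_label _ := rfl
  map_base := rfl

theorem PGraph.isPath_corePart {X : Type u} {Γ : PGraph.{u, v} X}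
    {p : List Γ.corePart.E} {x y : Γ.corePart.V} :
    Γ.corePart.IsPath p x y ↔ Γ.IsPath (p.map Γ.incl.onE) (Γ.incl.onV x) (Γ.incl.onV y) := by
  induction p generalizing x with
  | nil => exact Subtype.ext_iff
  | cons e p ih => exact and_congr Subtype.ext_iff ih

theorem PGraph.isReduced_corePart {X : Type u} {Γ : PGraph.{u, v} X}
    {p : List Γ.corePart.E} :
    Γ.corePart.IsReduced p ↔ Γ.IsReduced (p.map Γ.incl.onE) := by
  unfold Graph.IsReduced
  have h : ∀ a b : Γ.corePart.E,
      b ≠ Γ.corePart.bar a ↔ Γ.incl.onE b ≠ Γ.bar (Γ.incl.onE a) := fun a b =>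
    not_congr Subtype.ext_iff
  rw [List.isChain_map]
  simp only [h]

theorem PGraph.exists_lift {X : Type u} {Γ : PGraph.{u, v} X} {p : List Γ.E}
    (h : ∀ e ∈ p, Γ.IsCoreEdge e) : ∃ q : List Γ.corePart.E, q.map Γ.incl.onE = p := by
  induction p with
  | nil => exact ⟨[], rfl⟩
  | cons e p ih =>
    obtain ⟨q, hq⟩ := ih fun f hf => h f (List.mem_cons_of_mem _ hf)
    exact ⟨⟨e, h e List.mem_cons_self⟩ :: q, congrArg (e :: ·) hq⟩

theorem Graph.isPath_split {Γ : Graph.{v}} {p q : List Γ.E} {x z : Γ.V}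
    (h : Γ.IsPath (p ++ q) x z) : ∃ y, Γ.IsPath p x y ∧ Γ.IsPath q y z := by
  induction p generalizing x with
  | nil => exact ⟨x, rfl, h⟩
  | cons e p ih =>
    obtain ⟨y, h1, h2⟩ := ih h.2
    exact ⟨y, ⟨h.1, h1⟩, h2⟩

/-- The core part of a folded pointed graph is a core graph. -/
def PGraph.toCore {X : Type u} (Γ : PGraph.{u, v} X) (hΓ : Γ.IsFolded) : CoreGraph.{u, v} X where
  toPGraph := Γ.corePart
  folded e f h h' := Subtype.ext (hΓ _ _ (congrArg Subtype.val h) h')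
  connected := by
    have key : ∀ x : Γ.corePart.V, ∃ p, Γ.corePart.IsPath p Γ.corePart.base x := by
      rintro ⟨x, rfl | ⟨e, ⟨p, hp, hr, he⟩, rfl⟩⟩
      · exact ⟨[], rfl⟩
      · obtain ⟨s, t, rfl⟩ := List.append_of_mem he
        obtain ⟨y, h1, h2⟩ := Graph.isPath_split hp
        obtain ⟨q, hq⟩ := PGraph.exists_lift (Γ := Γ) (p := s)
          fun f hf => ⟨_, hp, hr, List.mem_append_left _ hf⟩
        refine ⟨q, PGraph.isPath_corePart.2 ?_⟩
        rw [hq]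
        have : Γ.ι e = y := h2.1
        subst this
        exact h1
    intro x y
    obtain ⟨p, hp⟩ := key x
    obtain ⟨q, hq⟩ := key y
    exact ⟨_, Graph.isPath_append (Graph.isPath_reverse hp) hq⟩
  core := by
    rintro ⟨e, p, hp, hr, he⟩
    obtain ⟨q, rfl⟩ := PGraph.exists_lift (Γ := Γ) (p := p) fun f hf => ⟨_, hp, hr, hf⟩
    refine ⟨q, PGraph.isPath_corePart.2 hp, PGraph.isReduced_corePart.2 hr, ?_⟩
    obtain ⟨f, hf, hfe⟩ := List.mem_map.1 he
    subst hfe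
    exact hf

theorem cover_folded {X : Type u} (H : Subgroup (FreeGroup X)) : (cover H).IsFolded :=
  fun _ _ h h' => Prod.ext h h'

/-- The core graph `Γ_X(H)` of a subgroup `H` of `F_X`. -/
def Gam {X : Type u} (H : Subgroup (FreeGroup X)) : CoreGraph.{u, u} X :=
  (cover H).toCore (cover_folded H)

/-- The morphism of covers of the rose `H g ↦ K g` for `H ≤ K`. -/
def cover.map {X : Type u} {H K : Subgroup (FreeGroup X)} (h : H ≤ K) :
    PHom (cover H) (cover K) where
  onV := Quotient.map' id fun a b hab => by
    rw [QuotientGroup.rightRel_apply] at hab ⊢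
    exact h hab
  onE e := (Quotient.map' id (fun a b hab => by
    rw [QuotientGroup.rightRel_apply] at hab ⊢
    exact h hab) e.1, e.2)
  map_ι _ := rfl
  map_bar := by
    rintro ⟨c, x⟩
    induction c using Quotient.inductionOn with
    | _ g => rfl
  map_label _ := rfl
  map_base := rfl

/-- Morphisms out of folded graphs map reduced paths to reduced paths. -/
theorem LHom.isReduced {X : Type u} {Γ : LGraph.{u, v} X} {Δ : LGraph.{u, w} X} (f : LHom Γ Δ)
    (hΓ : Γ.IsFolded) {p : List Γ.E} {x y : Γ.V} (hp : Γ.IsPath p x y) (hr : Γ.IsReduced p) :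
    Δ.IsReduced (p.map f.onE) := by
  induction p generalizing x with
  | nil => exact List.isChain_nil
  | cons e p ih =>
    cases p with
    | nil => exact List.isChain_singleton _
    | cons e' p =>
      obtain ⟨h1, h2⟩ := List.isChain_cons_cons.1 hr
      refine List.isChain_cons_cons.2 ⟨fun h => h1 (hΓ _ _ hp.2.1 ?_), ih hp.2 h2⟩
      rw [← f.map_label, h, ← f.map_bar, f.map_label]

theorem PHom.isCoreEdge {X : Type u} {Γ : PGraph.{u, v} X} {Δ : PGraph.{u, w} X} (f : PHom Γ Δ)
    (hΓ : Γ.IsFolded) {e : Γ.E} (h : Γ.IsCoreEdge e) : Δ.IsCoreEdge (f.onE e) := by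
  obtain ⟨p, hp, hr, he⟩ := h
  refine ⟨p.map f.onE, ?_, f.toLHom.isReduced hΓ hp hr, List.mem_map_of_mem he⟩
  have := f.toLHom.isPath hp
  rwa [f.map_base] at this

/-- The restriction of a morphism of pointed folded graphs to the core parts. -/
def PHom.corePart {X : Type u} {Γ : PGraph.{u, v} X} {Δ : PGraph.{u, w} X} (f : PHom Γ Δ)
    (hΓ : Γ.IsFolded) : PHom Γ.corePart Δ.corePart where
  onV x := ⟨f.onV x.1, by
    obtain ⟨x, rfl | ⟨e, he, rfl⟩⟩ := x
    · exact Or.inl f.map_base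
    · exact Or.inr ⟨f.onE e, f.isCoreEdge hΓ he, f.map_ι e⟩⟩
  onE e := ⟨f.onE e.1, f.isCoreEdge hΓ e.2⟩
  map_ι e := Subtype.ext (f.map_ι e.1)
  map_bar e := Subtype.ext (f.map_bar e.1)
  map_label e := f.map_label e.1
  map_base := Subtype.ext f.map_base

/-- The (unique) morphism of pointed core graphs `Γ_X(H) → Γ_X(K)` for `H ≤ K`. -/
def Gam.map {X : Type u} {H K : Subgroup (FreeGroup X)} (h : H ≤ K) :
    PHom (Gam H).toPGraph (Gam K).toPGraph :=
  (cover.map h).corePart (cover_folded H)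

/-! ### Check: `π₁(Γ_X(H)) = H` -/

theorem cover_isPath {X : Type u} {H : Subgroup (FreeGroup X)} {p : List (cover H).E}
    {c d : RCoset H} (h : (cover H).IsPath p c d) : d = c.smul ((cover H).pathLabel p) := by
  induction p generalizing c with
  | nil => exact (h : c = d).symm.trans (RCoset.smul_one c).symm
  | cons e p ih =>
    rw [ih h.2]
    obtain ⟨rfl, -⟩ := h
    show (RCoset.smul _ _).smul _ = _
    rw [RCoset.smul_smul]
    rfl

theorem cover_exists_path {X : Type u} (H : Subgroup (FreeGroup X)) (L : List (X × Bool))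
    (c : RCoset H) : ∃ p : List (cover H).E, p.map (cover H).label = L ∧
      (cover H).IsPath p c (c.smul (FreeGroup.mk L)) := by
  induction L generalizing c with
  | nil => exact ⟨[], rfl, (RCoset.smul_one c).symm⟩
  | cons x L ih =>
    obtain ⟨p, hp, hp'⟩ := ih (c.smul (letter x))
    refine ⟨(c, x) :: p, congrArg (x :: ·) hp, rfl, ?_⟩
    rw [RCoset.smul_smul] at hp'
    exact hp'

theorem π₁_Gam {X : Type u} (H : Subgroup (FreeGroup X)) : (Gam H).π₁ = H := by
  classical
  ext g
  constructor
  · rintro ⟨p, hp, rfl⟩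
    have h1 := cover_isPath (PGraph.isPath_corePart.1 hp)
    have h2 : RCoset.mk H 1 = RCoset.mk H (1 * (Gam H).pathLabel p) := by
      refine h1.trans ?_
      rw [← RCoset.smul_mk]
      exact congrArg (RCoset.smul _) ((cover H).incl.toLHom.pathLabel p)
    simpa using RCoset.mk_eq.1 h2
  · intro hg
    obtain ⟨p, hp, hp'⟩ := cover_exists_path H g.toWord (RCoset.mk H 1)
    rw [FreeGroup.mk_toWord, RCoset.smul_mk, one_mul,
      (RCoset.mk_eq (H := H) (g := g) (g' := 1)).2 (by simpa using hg)] at hp'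
    have hr : (cover H).IsReduced p := by
      have h := FreeGroup.isReduced_toWord (x := g)
      rw [← hp, FreeGroup.IsReduced, List.isChain_map] at h
      refine h.imp ?_
      rintro a b hab rfl
      simpa [cover, inv] using hab rfl
    obtain ⟨q, rfl⟩ := PGraph.exists_lift (Γ := cover H) (p := p)
      fun f hf => ⟨_, hp', hr, hf⟩
    refine ⟨q, PGraph.isPath_corePart.2 hp', ?_⟩
    have h := (cover H).incl.toLHom.pathLabel q
    rw [LGraph.pathLabel, hp, FreeGroup.mk_toWord] at h
    exact h.symm

/-! ## The functor `Core` -/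

/-- `Core(Γ)` is the core graph with `π₁(Core(Γ)) = π₁(Γ)`. -/
def Core {X : Type u} (Γ : PGraph.{u, v} X) : CoreGraph.{u, u} X := Gam Γ.π₁

/-- The functor `Core` on morphisms. -/
def Core.map {X : Type u} {Γ : PGraph.{u, v} X} {Δ : PGraph.{u, w} X} (f : PHom Γ Δ) :
    PHom (Core Γ).toPGraph (Core Δ).toPGraph :=
  Gam.map f.π₁_le

/-! ## The functor `𝓕_φ` -/

/-- A homomorphism of free groups is non-degenerate if no generator is mapped to `1`. -/
def NonDegenerate {X : Type u} {Y : Type w} (φ : FreeGroup Y →* FreeGroup X) : Prop :=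
  ∀ y, φ (FreeGroup.of y) ≠ 1

/-- The reduced word of `φ(y)`. -/
noncomputable def word {X : Type u} {Y : Type w} (φ : FreeGroup Y →* FreeGroup X) (y : Y) :
    List (X × Bool) :=
  @FreeGroup.toWord X (Classical.decEq X) (φ (FreeGroup.of y))

/-- The reduced word of `φ(l(e))` for an edge `e` with label in `Y`. -/
noncomputable def edgeWord {X : Type u} {Y : Type w} (φ : FreeGroup Y →* FreeGroup X)
    (Δ : LGraph.{w, v} Y) (e : Δ.E) : List (X × Bool) :=
  word φ (Δ.label e).1

/-- Vertices of `𝓕_φ(Δ)`: the vertices of `Δ`, and for every edge `e` with label in `Y` the interior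
vertices `(e, k)`, `0 < k < n`, of a path of length `n = |φ(l(e))|`. -/
abbrev FV {X : Type u} {Y : Type w} (φ : FreeGroup Y →* FreeGroup X) (Δ : LGraph.{w, v} Y) :
    Type v :=
  Δ.V ⊕ {t : Δ.E × ℕ // (Δ.label t.1).2 = true ∧ 0 < t.2 ∧ t.2 < (edgeWord φ Δ t.1).length}

/-- Edges of `𝓕_φ(Δ)`: for every edge `e` with label in `Y` and every `k < n = |φ(l(e))|`, an edge
`(e, k, true)` from the `k`-th to the `(k+1)`-st vertex of the path that replaces `e`, and its
inverse `(e, k, false)`. -/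
abbrev FE {X : Type u} {Y : Type w} (φ : FreeGroup Y →* FreeGroup X) (Δ : LGraph.{w, v} Y) :
    Type v :=
  {t : Δ.E × ℕ × Bool // (Δ.label t.1).2 = true ∧ t.2.1 < (edgeWord φ Δ t.1).length}

open Classical in
/-- The `k`-th vertex, `0 ≤ k ≤ n`, of the path of length `n = |φ(l(e))|` that replaces the edge `e`:
it starts at the initial vertex of `e` and ends at the terminal vertex of `e`. -/
noncomputable def pathVertex {X : Type u} {Y : Type w} (φ : FreeGroup Y →* FreeGroup X)
    (Δ : LGraph.{w, v} Y) (e : Δ.E) (he : (Δ.label e).2 = true) (k : ℕ) : FV φ Δ :=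
  if h : 0 < k ∧ k < (edgeWord φ Δ e).length then Sum.inr ⟨(e, k), he, h.1, h.2⟩
  else if k = 0 then Sum.inl (Δ.ι e) else Sum.inl (Δ.τ e)

/-- `𝓕_φ(Δ)` for a non-degenerate `φ : F_Y → F_X` and a `Y`-labeled graph `Δ`: every edge of `Δ` with a
label `y ∈ Y` is replaced by a path whose label is the reduced word of `φ(y)`. -/
noncomputable def F {X : Type u} {Y : Type w} (φ : FreeGroup Y →* FreeGroup X)
    (Δ : LGraph.{w, v} Y) : LGraph.{u, v} X where
  V := FV φ Δ
  E := FE φ Δ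
  ι t := pathVertex φ Δ t.1.1 t.2.1 (if t.1.2.2 then t.1.2.1 else t.1.2.1 + 1)
  bar t := ⟨(t.1.1, t.1.2.1, !t.1.2.2), t.2⟩
  bar_ne t h := by
    have := congrArg (fun s => s.1.2.2) h
    simp at this
  bar_bar t := by
    refine Subtype.ext ?_
    simp
  label t :=
    if t.1.2.2 then (edgeWord φ Δ t.1.1)[t.1.2.1]'t.2.2
    else inv ((edgeWord φ Δ t.1.1)[t.1.2.1]'t.2.2)
  label_bar t := by
    obtain ⟨⟨e, k, b⟩, h⟩ := t
    cases b <;> simp [inv]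

/-- `𝓕_φ` on pointed graphs. -/
noncomputable def PF {X : Type u} {Y : Type w} (φ : FreeGroup Y →* FreeGroup X)
    (Δ : PGraph.{w, v} Y) : PGraph.{u, v} X where
  toLGraph := F φ Δ.toLGraph
  base := Sum.inl Δ.base

theorem edgeWord_map {X : Type u} {Y : Type w} (φ : FreeGroup Y →* FreeGroup X)
    {Δ Ξ : LGraph.{w, v} Y} (f : LHom Δ Ξ) (e : Δ.E) :
    edgeWord φ Ξ (f.onE e) = edgeWord φ Δ e := by
  rw [edgeWord, f.map_label]; rfl

theorem pathVertex_map {X : Type u} {Y : Type w} (φ : FreeGroup Y →* FreeGroup X)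
    {Δ Ξ : LGraph.{w, v} Y} (f : LHom Δ Ξ) (e : Δ.E) (he : (Δ.label e).2 = true)
    (he' : (Ξ.label (f.onE e)).2 = true) (k : ℕ) :
    pathVertex φ Ξ (f.onE e) he' k =
      Sum.map f.onV (fun t => ⟨(f.onE t.1.1, t.1.2), by
        rw [f.map_label, edgeWord_map]; exact t.2⟩) (pathVertex φ Δ e he k) := by
  unfold pathVertex
  simp only [edgeWord_map]
  split_ifs <;> simp [f.map_ι, f.map_τ]

/-- `𝓕_φ(f)` maps the path that replaces `e` to the path that replaces `f(e)`. -/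
noncomputable def F.map {X : Type u} {Y : Type w} (φ : FreeGroup Y →* FreeGroup X)
    {Δ Ξ : LGraph.{w, v} Y} (f : LHom Δ Ξ) : LHom (F φ Δ) (F φ Ξ) where
  onV := Sum.map f.onV fun t => ⟨(f.onE t.1.1, t.1.2), by
    rw [f.map_label, edgeWord_map]; exact t.2⟩
  onE t := ⟨(f.onE t.1.1, t.1.2), by rw [f.map_label, edgeWord_map]; exact t.2⟩
  map_ι t := pathVertex_map φ f t.1.1 t.2.1 (by rw [f.map_label]; exact t.2.1) _
  map_bar _ := rfl
  map_label t := by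
    show (if t.1.2.2 then _ else _) = if t.1.2.2 then _ else _
    simp only [edgeWord_map]

/-- `𝓕_φ` on morphisms of pointed graphs. -/
noncomputable def PF.map {X : Type u} {Y : Type w} (φ : FreeGroup Y →* FreeGroup X)
    {Δ Ξ : PGraph.{w, v} Y} (f : PHom Δ Ξ) : PHom (PF φ Δ) (PF φ Ξ) where
  toLHom := F.map φ f.toLHom
  map_base := congrArg (Sum.inl : Ξ.V → FV φ Ξ.toLGraph) f.map_base

/-! ## The functor `Trimf` (forget the base point, then trim) -/

/-- The vertices that are removed by iterated trimming: a vertex `x` is removed if it has an edge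
`e` such that all other edges at `x` lead to removed vertices, that is, if `x` has valency one
after finitely many trimmings (none is needed if `e` is the only edge at `x`).  In a pointed core
graph only the base point can have valency one, so these are the vertices of the tail. -/
inductive Graph.IsTrimmed (Γ : Graph.{v}) : Γ.V → Prop
  | intro (e : Γ.E) (h : ∀ e', Γ.ι e' = Γ.ι e → e' ≠ e → Γ.IsTrimmed (Γ.τ e')) :
      Γ.IsTrimmed (Γ.ι e)

/-- `Trimf(Γ)`: the graph without base point obtained by deleting the tail. -/
def Trimf {X : Type u} (Γ : CoreGraph.{u, v} X) : LGraph.{u, v} X where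
  V := {x : Γ.V // ¬ Γ.IsTrimmed x}
  E := {e : Γ.E // ¬ Γ.IsTrimmed (Γ.ι e) ∧ ¬ Γ.IsTrimmed (Γ.τ e)}
  ι e := ⟨Γ.ι e.1, e.2.1⟩
  bar e := ⟨Γ.bar e.1, e.2.2, by rw [Graph.τ, Γ.bar_bar]; exact e.2.1⟩
  bar_ne e h := Γ.bar_ne e.1 (congrArg Subtype.val h)
  bar_bar e := Subtype.ext (Γ.bar_bar e.1)
  label e := Γ.label e.1
  label_bar e := Γ.label_bar e.1

theorem isTrimmed_of_map {X : Type u} {Γ : CoreGraph.{u, v} X} {Δ : CoreGraph.{u, w} X}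
    (f : PHom Γ.toPGraph Δ.toPGraph) (hE : Nonempty Γ.E) (x : Γ.V)
    (hx : Δ.IsTrimmed (f.onV x)) : Γ.IsTrimmed x := by
  have hex : ∀ x : Γ.V, ∃ e, Γ.ι e = x := by
    intro x
    obtain ⟨e⟩ := hE
    obtain ⟨p, hp⟩ := Γ.connected x (Γ.ι e)
    cases p with
    | nil => exact ⟨e, hp.symm⟩
    | cons e' p => exact ⟨e', hp.1⟩
  generalize hy : f.onV x = y at hx
  induction hx generalizing x with
  | intro e h ih =>
    by_cases hc : ∃ e₀, Γ.ι e₀ = x ∧ f.onE e₀ = e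
    · obtain ⟨e₀, rfl, rfl⟩ := hc
      refine Graph.IsTrimmed.intro e₀ fun e' h' hne => ?_
      refine ih (f.onE e') ?_ ?_ _ (f.map_τ e').symm
      · rw [f.map_ι, f.map_ι, h']
      · intro h2
        refine hne (Γ.folded _ _ h' ?_)
        rw [← f.map_label, h2, f.map_label]
    · obtain ⟨e₀, rfl⟩ := hex x
      refine Graph.IsTrimmed.intro e₀ fun e' h' hne => ?_
      refine ih (f.onE e') ?_ ?_ _ (f.map_τ e').symm
      · rw [f.map_ι, h', hy]
      · intro h2
        exact hc ⟨e', h', h2⟩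

/-- `Trimf` on morphisms: the restriction of `f : Γ → Δ` to `Trimf(Γ)`.  It has values in `Trimf(Δ)`
unless `Γ` is a single vertex (the core graph of the trivial group). -/
def Trimf.map {X : Type u} {Γ : CoreGraph.{u, v} X} {Δ : CoreGraph.{u, w} X}
    (f : PHom Γ.toPGraph Δ.toPGraph) (hE : Nonempty Γ.E) : LHom (Trimf Γ) (Trimf Δ) where
  onV x := ⟨f.onV x.1, fun h => x.2 (isTrimmed_of_map f hE _ h)⟩
  onE e := ⟨f.onE e.1, by
    rw [f.map_ι, f.map_τ]
    exact ⟨fun h => e.2.1 (isTrimmed_of_map f hE _ h), fun h => e.2.2 (isTrimmed_of_map f hE _ h)⟩⟩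
  map_ι e := Subtype.ext (f.map_ι e.1)
  map_bar e := Subtype.ext (f.map_bar e.1)
  map_label e := f.map_label e.1

theorem Gam_nonempty {X : Type u} {H : Subgroup (FreeGroup X)} {g : FreeGroup X} (hg : g ∈ H)
    (h1 : g ≠ 1) : Nonempty (Gam H).E := by
  rw [← π₁_Gam H] at hg
  obtain ⟨p, -, rfl⟩ := hg
  cases p with
  | nil => exact absurd rfl h1
  | cons e p => exact ⟨e⟩

/-! ### Check: `φ(π₁(Δ)) ≤ π₁(𝓕_φ(Δ))` -/

theorem F_path {X : Type u} {Y : Type w} {φ : FreeGroup Y →* FreeGroup X}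
    (hφ : NonDegenerate φ) (Δ : LGraph.{w, v} Y) (e : Δ.E) (he : (Δ.label e).2 = true) :
    ∃ p, (F φ Δ).IsPath p (Sum.inl (Δ.ι e)) (Sum.inl (Δ.τ e)) ∧
      (F φ Δ).pathLabel p = φ (FreeGroup.of (Δ.label e).1) := by
  classical
  have hn : edgeWord φ Δ e ≠ [] := fun h => hφ _ (FreeGroup.toWord_eq_nil_iff.1 h)
  have key : ∀ m k, k + m = (edgeWord φ Δ e).length → ∃ p,
      (F φ Δ).IsPath p (pathVertex φ Δ e he k) (Sum.inl (Δ.τ e)) ∧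
      p.map (F φ Δ).label = (edgeWord φ Δ e).drop k := by
    intro m
    induction m with
    | zero =>
      intro k hk
      have : k ≠ 0 := by
        rintro rfl
        exact hn (List.length_eq_zero_iff.1 hk.symm)
      refine ⟨[], ?_, ?_⟩
      · show pathVertex φ Δ e he k = _
        unfold pathVertex
        rw [dif_neg (by omega), if_neg this]
      · simp [← hk]
    | succ m ih =>
      intro k hk
      obtain ⟨p, hp, hp'⟩ := ih (k + 1) (by omega)
      refine ⟨⟨(e, k, true), he, by show k < (edgeWord φ Δ e).length; omega⟩ :: p, ⟨rfl, hp⟩, ?_⟩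
      rw [List.drop_eq_getElem_cons (i := k) (by omega), ← hp']
      rfl
  obtain ⟨p, hp, hp'⟩ := key _ 0 (zero_add _)
  refine ⟨p, ?_, ?_⟩
  · have : pathVertex φ Δ e he 0 = Sum.inl (Δ.ι e) := by simp [pathVertex]
    rwa [this] at hp
  · rw [LGraph.pathLabel, hp', List.drop_zero]
    exact @FreeGroup.mk_toWord X (Classical.decEq X) _

theorem le_π₁_PF {X : Type u} {Y : Type w} {φ : FreeGroup Y →* FreeGroup X}
    (hφ : NonDegenerate φ) (Δ : PGraph.{w, v} Y) : Δ.π₁.map φ ≤ (PF φ Δ).π₁ := by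
  have key : ∀ (p : List Δ.E) (x y : Δ.V), Δ.IsPath p x y → ∃ q,
      (F φ Δ.toLGraph).IsPath q (Sum.inl x) (Sum.inl y) ∧
      (F φ Δ.toLGraph).pathLabel q = φ (Δ.pathLabel p) := by
    intro p
    induction p with
    | nil => exact fun x y h => ⟨[], congrArg Sum.inl h, (map_one φ).symm⟩
    | cons e p ih =>
      rintro x y ⟨rfl, h⟩
      obtain ⟨q, hq, hq'⟩ := ih _ _ h
      have hstep : ∃ r, (F φ Δ.toLGraph).IsPath r (Sum.inl (Δ.ι e)) (Sum.inl (Δ.τ e)) ∧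
          (F φ Δ.toLGraph).pathLabel r = φ (letter (Δ.label e)) := by
        rcases hl : Δ.label e with ⟨y, b⟩
        cases b with
        | true =>
          obtain ⟨r, hr, hr'⟩ := F_path hφ Δ.toLGraph e (by rw [hl])
          exact ⟨r, hr, by rw [hr', hl]; rfl⟩
        | false =>
          have hb : Δ.label (Δ.bar e) = (y, true) := by rw [Δ.label_bar, hl]; rfl
          obtain ⟨r, hr, hr'⟩ := F_path hφ Δ.toLGraph (Δ.bar e) (by rw [hb])
          have h1 := Graph.isPath_reverse hr
          rw [Graph.τ, Δ.bar_bar] at h1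
          refine ⟨_, h1, ?_⟩
          · rw [hb] at hr'
            have : letter (y, false) = (FreeGroup.of y)⁻¹ := rfl
            rw [this, map_inv, ← hr']
            simp only [LGraph.pathLabel, FreeGroup.inv_mk, FreeGroup.invRev, List.map_reverse,
              List.map_map]
            congr 2
            exact List.map_congr_left fun e _ => (F φ Δ.toLGraph).label_bar e
      obtain ⟨r, hr, hr'⟩ := hstep
      refine ⟨r ++ q, Graph.isPath_append hr hq, ?_⟩
      have h1 : Δ.pathLabel (e :: p) = letter (Δ.label e) * Δ.pathLabel p := rfl
      rw [h1, map_mul, ← hr', ← hq']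
      simp [LGraph.pathLabel, FreeGroup.mul_mk]
  rintro _ ⟨_, ⟨p, hp, rfl⟩, rfl⟩
  obtain ⟨q, hq, hq'⟩ := key p _ _ hp
  exact ⟨q, hq, hq'⟩

/-! ## The extension `⟨b⟩ ≤ ⟨b, a b a⁻¹⟩` in `F_{a,b}` -/

/-- The alphabet `{a, b}`. -/
inductive AB : Type
  | a
  | b

/-- The free group `F_{a,b}`. -/
abbrev Fab : Type := FreeGroup AB

/-- The generator `a`. -/
def gA : Fab := FreeGroup.of AB.a

/-- The generator `b`. -/
def gB : Fab := FreeGroup.of AB.b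

/-- The subgroup `⟨b⟩`. -/
def H₀ : Subgroup Fab := Subgroup.closure {gB}

/-- The subgroup `⟨b, a b a⁻¹⟩`. -/
def K₀ : Subgroup Fab := Subgroup.closure {gB, gA * gB * gA⁻¹}

theorem H₀_le_K₀ : H₀ ≤ K₀ := Subgroup.closure_mono (by simp)

theorem gB_mem : gB ∈ H₀ := Subgroup.subset_closure rfl

/-- `Γ = Γ_{a,b}(⟨b⟩)`. -/
def Γ₀ : CoreGraph.{0, 0} AB := Gam H₀

/-- `Δ = Γ_{a,b}(⟨b, a b a⁻¹⟩)`. -/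
def Δ₀ : CoreGraph.{0, 0} AB := Gam K₀

/-- The morphism `Γ → Δ`. -/
def mor₀ : PHom Γ₀.toPGraph Δ₀.toPGraph := Gam.map H₀_le_K₀

theorem core_nonempty {X : Type u} {φ : Fab →* FreeGroup X} (hφ : NonDegenerate φ) :
    Nonempty (Core (PF φ Γ₀.toPGraph)).E := by
  refine Gam_nonempty (g := φ gB) (le_π₁_PF hφ _ ⟨gB, ?_, rfl⟩) (hφ AB.b)
  exact (π₁_Gam H₀).symm ▸ gB_mem

/-- The morphism of unpointed graphs `Trimf ∘ Core ∘ 𝓕_φ (Γ → Δ)`. -/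
noncomputable def unpointedMor {X : Type u} (φ : Fab →* FreeGroup X) (hφ : NonDegenerate φ) :
    LHom (Trimf (Core (PF φ Γ₀.toPGraph))) (Trimf (Core (PF φ Δ₀.toPGraph))) :=
  Trimf.map (Core.map (PF.map φ mor₀)) (core_nonempty hφ)

/-- For an injective homomorphism `ψ : F_{a,b} → F_Y`, the morphism of unpointed core graphs
`Trimf (Γ_Y(ψ⟨b⟩) → Γ_Y(ψ⟨b, a b a⁻¹⟩))`. -/
def extMor {Y : Type u} (ψ : Fab →* FreeGroup Y) (hψ : Function.Injective ψ) :
    LHom (Trimf (Gam (H₀.map ψ))) (Trimf (Gam (K₀.map ψ))) :=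
  Trimf.map (Gam.map (Subgroup.map_mono H₀_le_K₀))
    (Gam_nonempty (Subgroup.mem_map_of_mem ψ gB_mem)
      fun h => FreeGroup.of_ne_one AB.b (hψ (h.trans (map_one ψ).symm)))

/-- The outer automorphism group `Out(G) = Aut(G) / Inn(G)` (as a set of classes). -/
abbrev Out (G : Type u) [Group G] : Type u := MulAut G ⧸ (MulAut.conj : G →* MulAut G).range

end CoreGraphs

/-! All three claims reduce to one statement about a free group: if `s ≠ 1`, `H = ⟨s⟩` and `K = ⟨s,
k s k⁻¹⟩`, then the trimmed core graph of `H` embeds in that of `K` (`Trimf_map_injective`). Every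
homomorphism sends `⟨b⟩ ≤ ⟨b, aba⁻¹⟩` to a pair of this shape. By `π₁_PF` the functor `𝓕_φ` changes
fundamental groups by `φ`, so part 1 is covered as well, even when `φ` has a kernel.

The pair is studied on the Cayley tree. Core edges are the orbits of edges on geodesics between
elements of the subgroup, and the vertices that survive trimming are the cosets of points on axes of
its non-trivial elements (`not_isTrimmed_iff`). So `Trimf` of `Γ(⟨s⟩)` is the axis of `s` modulo
`⟨s⟩`, and injectivity says: an element of `K` that carries one point of this axis to another is a
power of `s`.

This is a ping-pong argument (`mem_zpowers_of_cycReduced`). The displacement `|g⁻¹ a g|` of `a` at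
the point `g` is the translation length of `a` plus twice the distance from `g` to the axis of `a`.
Conjugate elements have equal translation lengths, so their displacements compare distances to the
axes. Unless `s` and its conjugate `t` agree up to inversion, a non-zero power of `t` moves any
point that is at least as close to the axis of `s` strictly closer to the axis of `t`, and vice
versa (`norm_lt_norm_conj_pow`). Hence an alternating product that is not a power of `s` never
returns a point of the axis of `s` to this axis.

The independence of the representative in `Out` is a change of base point: conjugate pairs of
subgroups have isomorphic trimmed morphisms (`Trimf_map_isIsomorphic`). -/

namespace CoreGraphs

/-! ## The tree metric on a free group -/

/-- The length of the longest common prefix of two lists. -/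
def lcpLength {α : Type u} [DecidableEq α] : List α → List α → ℕ
  | a :: l, b :: m => if a = b then lcpLength l m + 1 else 0
  | _, _ => 0

theorem lcpLength_comm {α : Type u} [DecidableEq α] (l m : List α) :
    lcpLength l m = lcpLength m l := by
  induction l generalizing m with
  | nil => cases m <;> rfl
  | cons a l ih =>
    cases m with
    | nil => rfl
    | cons b m => simp only [lcpLength, ih m, eq_comm]

theorem min_lcpLength_le {α : Type u} [DecidableEq α] (l m k : List α) :
    min (lcpLength l m) (lcpLength m k) ≤ lcpLength l k := by
  induction l generalizing m k with
  | nil => simp [lcpLength]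
  | cons a l ih =>
    cases m with
    | nil => simp [lcpLength]
    | cons b m =>
      cases k with
      | nil => simp [lcpLength]
      | cons c k =>
        have := ih m k
        simp only [lcpLength]
        split_ifs <;> first | omega | simp_all

theorem isReduced_invRev {X : Type u} {L : List (X × Bool)} (h : FreeGroup.IsReduced L) :
    FreeGroup.IsReduced (FreeGroup.invRev L) := by
  classical
  rw [FreeGroup.isReduced_iff_reduce_eq] at h ⊢
  rw [FreeGroup.reduce_invRev, h]

theorem norm_mk_of_isReduced {X : Type u} [DecidableEq X] {L : List (X × Bool)}
    (h : FreeGroup.IsReduced L) : (FreeGroup.mk L).norm = L.length := by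
  rw [FreeGroup.norm, FreeGroup.toWord_mk, h.reduce_eq]

/-- Cancellation in `l⁻¹ m` removes exactly the common prefix; once the first letters differ,
`invRev l ++ m` is already reduced. This identity turns most of the later word combinatorics into
arithmetic of lengths. -/
theorem norm_inv_mk_mul_mk {X : Type u} [DecidableEq X] (l m : List (X × Bool))
    (hl : FreeGroup.IsReduced l) (hm : FreeGroup.IsReduced m) :
    ((FreeGroup.mk l)⁻¹ * FreeGroup.mk m).norm + 2 * lcpLength l m = l.length + m.length := by
  induction l generalizing m with
  | nil =>
    rw [← FreeGroup.one_eq_mk, inv_one, one_mul, norm_mk_of_isReduced hm]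
    simp [lcpLength]
  | cons a l ih =>
    cases m with
    | nil =>
      rw [← FreeGroup.one_eq_mk, mul_one, FreeGroup.norm_inv_eq, norm_mk_of_isReduced hl]
      simp [lcpLength]
    | cons b m =>
      by_cases hab : a = b
      · subst hab
        have h1 : ∀ k : List (X × Bool), FreeGroup.mk (a :: k) = FreeGroup.mk [a] * FreeGroup.mk k :=
          fun k => by rw [FreeGroup.mul_mk]; rfl
        rw [h1 l, h1 m, mul_inv_rev, mul_assoc, inv_mul_cancel_left]
        have := ih m (List.IsChain.tail hl) (List.IsChain.tail hm)
        simp only [lcpLength, if_true, List.length_cons]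
        omega
      · rw [FreeGroup.inv_mk, FreeGroup.mul_mk, norm_mk_of_isReduced]
        · simp [lcpLength, hab]
        · refine List.IsChain.append (isReduced_invRev hl) hm ?_
          intro x hx y hy hxy
          have hx' : (a.1, !a.2) = x := by
            simpa [FreeGroup.invRev] using hx
          have hy' : b = y := by simpa using hy
          subst hx' hy'
          by_contra hne
          refine hab (Prod.ext hxy ?_)
          revert hne
          cases a.2 <;> cases b.2 <;> simp

section Metric

variable {X : Type u} [DecidableEq X]

/-- The Gromov product of two elements of a free group, that is, the length of the longest common
prefix of their reduced words. -/
def gromov (g h : FreeGroup X) : ℕ := lcpLength g.toWord h.toWord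

theorem gromov_comm (g h : FreeGroup X) : gromov g h = gromov h g := lcpLength_comm _ _

theorem min_gromov_le (g h k : FreeGroup X) : min (gromov g h) (gromov h k) ≤ gromov g k :=
  min_lcpLength_le _ _ _

theorem norm_inv_mul (g h : FreeGroup X) :
    (g⁻¹ * h).norm + 2 * gromov g h = g.norm + h.norm := by
  have := norm_inv_mk_mul_mk g.toWord h.toWord FreeGroup.isReduced_toWord
    FreeGroup.isReduced_toWord
  rwa [FreeGroup.mk_toWord, FreeGroup.mk_toWord] at this

theorem norm_mul (g h : FreeGroup X) :
    (g * h).norm + 2 * gromov g⁻¹ h = g.norm + h.norm := by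
  have := norm_inv_mul g⁻¹ h
  rwa [inv_inv, FreeGroup.norm_inv_eq] at this

theorem gromov_self (g : FreeGroup X) : gromov g g = g.norm := by
  have := norm_inv_mul g g
  rw [inv_mul_cancel, FreeGroup.norm_one] at this
  omega

/-- A positive Gromov product means equal first letters, that is, the same direction at the base
point of the tree. -/
theorem gromov_pos_trans {g h k : FreeGroup X} (h1 : 0 < gromov g h) (h2 : 0 < gromov h k) :
    0 < gromov g k :=
  lt_of_lt_of_le (lt_min h1 h2) (min_gromov_le g h k)

theorem norm_pos {g : FreeGroup X} (hg : g ≠ 1) : 0 < g.norm :=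
  Nat.pos_of_ne_zero fun h => hg (FreeGroup.norm_eq_zero.1 h)

/-- The distance in the Cayley tree. -/
def dist (g h : FreeGroup X) : ℕ := (g⁻¹ * h).norm

theorem dist_comm (g h : FreeGroup X) : dist g h = dist h g := by
  rw [dist, ← FreeGroup.norm_inv_eq, mul_inv_rev, inv_inv, dist]

theorem dist_mul_left (k g h : FreeGroup X) : dist (k * g) (k * h) = dist g h := by
  rw [dist, dist, mul_inv_rev, mul_assoc, inv_mul_cancel_left]

theorem dist_triangle (g h k : FreeGroup X) : dist g k ≤ dist g h + dist h k := by
  have := FreeGroup.norm_mul_le (g⁻¹ * h) (h⁻¹ * k)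
  rwa [mul_assoc, mul_inv_cancel_left] at this

theorem dist_one_left (g : FreeGroup X) : dist 1 g = g.norm := by simp [dist]

theorem dist_one_right (g : FreeGroup X) : dist g 1 = g.norm := by simp [dist]

theorem eq_of_dist_eq_zero {g h : FreeGroup X} (hd : dist g h = 0) : g = h :=
  (inv_mul_eq_one.1 (FreeGroup.norm_eq_zero.1 hd))

/-- The four point condition: the Cayley graph is a tree. -/
theorem four_point (x y z p : FreeGroup X) :
    dist x z + dist y p ≤ dist x p + dist y z ∨ dist x z + dist y p ≤ dist z p + dist x y := by
  have key : ∀ y z p : FreeGroup X, z.norm + dist y p ≤ p.norm + dist y z ∨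
      z.norm + dist y p ≤ dist z p + y.norm := by
    intro y z p
    have h1 := norm_inv_mul y p
    have h2 := norm_inv_mul y z
    have h3 := norm_inv_mul z p
    have h4 := min_gromov_le y z p
    simp only [dist]
    omega
  -- Left translation moves `x` to `1`, where the inequality is the ultrametric property of common
  -- prefixes.
  have := key (x⁻¹ * y) (x⁻¹ * z) (x⁻¹ * p)
  simp only [dist_mul_left] at this
  exact this

/-- The distance to a point of a geodesic. -/
theorem dist_le_of_between {x y z : FreeGroup X} (h : dist x y + dist y z = dist x z)
    (p : FreeGroup X) : dist y p + dist x y ≤ dist x p ∨ dist y p + dist y z ≤ dist z p := by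
  have := four_point x y z p
  omega

/-! ### Letters -/

theorem toWord_letter (x : X × Bool) : (letter x).toWord = [x] := by
  rw [letter, FreeGroup.toWord_mk, FreeGroup.reduce_singleton]

theorem norm_letter (x : X × Bool) : (letter x).norm = 1 := by
  rw [FreeGroup.norm, toWord_letter]; rfl

theorem eq_of_gromov_letter_pos {x y : X × Bool} (h : 0 < gromov (letter x) (letter y)) :
    x = y := by
  by_contra hne
  simp [gromov, toWord_letter, lcpLength, hne] at h

theorem exists_letter {g : FreeGroup X} (hg : g ≠ 1) : ∃ x, 0 < gromov (letter x) g := by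
  have h : g.toWord ≠ [] := fun h => hg (FreeGroup.toWord_eq_nil_iff.1 h)
  obtain ⟨x, l, hl⟩ := List.exists_cons_of_ne_nil h
  exact ⟨x, by simp [gromov, toWord_letter, hl, lcpLength]⟩

theorem gromov_letter_le (x : X × Bool) (g : FreeGroup X) : gromov (letter x) g ≤ 1 := by
  have h1 := FreeGroup.norm_mul_le (letter x) ((letter x)⁻¹ * g)
  have h2 := norm_inv_mul (letter x) g
  rw [mul_inv_cancel_left] at h1
  have h3 := norm_letter x
  omega

/-! ### Cyclically reduced elements and conjugation -/

/-- An element is cyclically reduced if its reduced word does not start with a letter and end with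
its inverse. -/
def CycReduced (g : FreeGroup X) : Prop := gromov g g⁻¹ = 0

theorem CycReduced.inv {g : FreeGroup X} (h : CycReduced g) : CycReduced g⁻¹ := by
  rw [CycReduced, inv_inv, gromov_comm]; exact h

theorem cycReduced_iff {g : FreeGroup X} : CycReduced g ↔ (g * g).norm = 2 * g.norm := by
  have := norm_mul g g
  rw [CycReduced, gromov_comm]
  omega

/-- By the lengths already known, `g` and `g ^ (k + 1)` share their first letter. Cancellation in `g
* g ^ (k + 1)` would make this also the first letter of `g⁻¹`. Two consecutive exponents are carried
through the induction because both lengths enter. -/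
theorem CycReduced.norm_pow {g : FreeGroup X} (h : CycReduced g) (k : ℕ) :
    (g ^ k).norm = k * g.norm := by
  by_cases hg : g = 1
  · simp [hg]
  have hpos := norm_pos hg
  have : ∀ k : ℕ, (g ^ k).norm = k * g.norm ∧ (g ^ (k + 1)).norm = (k + 1) * g.norm := by
    intro k
    induction k with
    | zero => simp
    | succ k ih =>
      refine ⟨ih.2, ?_⟩
      have h1 := norm_inv_mul g (g ^ (k + 1))
      rw [show g⁻¹ * g ^ (k + 1) = g ^ k by rw [pow_succ']; group, ih.1, ih.2] at h1
      have h2 := norm_mul g (g ^ (k + 1))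
      rw [← pow_succ', ih.2] at h2
      have h3 : gromov g⁻¹ (g ^ (k + 1)) = 0 := by
        by_contra hne
        have h5 : 0 < gromov g (g ^ (k + 1)) := by
          by_contra h0
          have : gromov g (g ^ (k + 1)) = 0 := by omega
          rw [this] at h1
          nlinarith
        rw [gromov_comm] at hne
        have := gromov_pos_trans h5 (Nat.pos_of_ne_zero hne)
        rw [CycReduced] at h
        omega
      rw [h3] at h2
      linarith
  exact (this k).1

theorem CycReduced.gromov_pow_pos {g : FreeGroup X} (h : CycReduced g) (hg : g ≠ 1) {k : ℕ}
    (hk : k ≠ 0) : 0 < gromov g (g ^ k) := by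
  obtain ⟨k, rfl⟩ := Nat.exists_eq_add_one_of_ne_zero hk
  have h1 := norm_inv_mul g (g ^ (k + 1))
  rw [show g⁻¹ * g ^ (k + 1) = g ^ k by rw [pow_succ']; group, h.norm_pow, h.norm_pow] at h1
  have := norm_pos hg
  by_contra h0
  have : gromov g (g ^ (k + 1)) = 0 := by omega
  rw [this] at h1
  nlinarith

/-- A cyclically reduced element has minimal length in its conjugacy class. -/
theorem CycReduced.norm_le {g : FreeGroup X} (h : CycReduced g) (k : FreeGroup X) :
    g.norm ≤ (k⁻¹ * g * k).norm := by
  by_contra hlt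
  set m := (k⁻¹ * g * k).norm with hm
  have h1 : ∀ j : ℕ, ((k⁻¹ * g * k) ^ j).norm ≤ j * m := by
    intro j
    induction j with
    | zero => simp
    | succ j ih =>
      rw [pow_succ]
      have := FreeGroup.norm_mul_le ((k⁻¹ * g * k) ^ j) (k⁻¹ * g * k)
      linarith
  -- Conjugation by `k` costs at most `2 |k|` in length, while a shorter conjugate would save at
  -- least one per factor; this exponent makes the saving win.
  have h2 := h1 (2 * k.norm + 1)
  have h3 : g ^ (2 * k.norm + 1) = k * (k⁻¹ * g * k) ^ (2 * k.norm + 1) * k⁻¹ := by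
    have : (k⁻¹ * g * k) = MulAut.conj k⁻¹ g := by simp
    rw [this, ← map_pow]
    simp [mul_assoc]
  have h4 := h.norm_pow (2 * k.norm + 1)
  rw [h3] at h4
  have h5 := FreeGroup.norm_mul_le (k * (k⁻¹ * g * k) ^ (2 * k.norm + 1)) k⁻¹
  have h6 := FreeGroup.norm_mul_le k ((k⁻¹ * g * k) ^ (2 * k.norm + 1))
  rw [FreeGroup.norm_inv_eq] at h5
  nlinarith

/-- Conjugation by an element that is not on the way to the axis. -/
theorem norm_conj_of_gromov_eq_zero {a g : FreeGroup X} (ha : a ≠ 1) (h1 : gromov g a = 0)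
    (h2 : gromov g a⁻¹ = 0) : (g⁻¹ * a * g).norm = a.norm + 2 * g.norm := by
  have h3 := norm_mul a g
  rw [gromov_comm, h2] at h3
  have h4 := norm_inv_mul (a * g) a
  rw [show (a * g)⁻¹ * a = g⁻¹ by group, FreeGroup.norm_inv_eq] at h4
  have h5 := norm_pos ha
  have h6 : gromov g (a * g) = 0 := by
    by_contra hne
    have := gromov_pos_trans (Nat.pos_of_ne_zero hne) (k := a) (by omega)
    omega
  have h7 := norm_inv_mul g (a * g)
  rw [h6, ← mul_assoc] at h7
  omega

/-- The reduced word starts with `x` and ends with its inverse, and the conjugation strips both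
letters. -/
theorem norm_conj_letter_of_not_cycReduced {a : FreeGroup X} (ha : ¬ CycReduced a) {x : X × Bool}
    (hx : 0 < gromov (letter x) a) :
    ((letter x)⁻¹ * a * letter x).norm + 2 = a.norm := by
  have h0 : 0 < gromov a a⁻¹ := Nat.pos_of_ne_zero ha
  have h1 := norm_inv_mul (letter x) a
  have h2 := norm_inv_mul a⁻¹ (a⁻¹ * letter x)
  have h3 := norm_inv_mul (a⁻¹ * letter x) (letter x)
  have h4 := gromov_letter_le x a
  have h5 := norm_letter x
  have h6 : (a⁻¹ * letter x).norm = ((letter x)⁻¹ * a).norm := by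
    rw [← FreeGroup.norm_inv_eq, mul_inv_rev, inv_inv]
  rw [show (a⁻¹)⁻¹ * (a⁻¹ * letter x) = letter x by group, FreeGroup.norm_inv_eq, h6] at h2
  rw [show (a⁻¹ * letter x)⁻¹ * letter x = (letter x)⁻¹ * a * letter x by group, h6] at h3
  have h7 := gromov_letter_le x (a⁻¹ * letter x)
  rw [gromov_comm] at h7
  -- Otherwise the cancellation in `a * a` would be complete, which the absence of torsion excludes.
  have h8 : 1 < a.norm := by
    have h9 := norm_mul a a
    rw [gromov_comm] at h9
    have h11 : a ≠ a⁻¹ * 1 := by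
      intro h
      have : a ^ 2 = 1 := by rw [pow_two]; nth_rewrite 1 [h]; group
      have h12 : a = 1 := by
        by_contra hne
        exact hne ((pow_eq_one_iff_left two_ne_zero).1 this)
      subst h12
      simp [gromov, lcpLength] at h0
    have h10 := norm_pos (g := a * a) fun h => h11 (by rw [mul_one]; exact eq_inv_of_mul_eq_one_left h)
    omega
  have h9 : 0 < gromov (a⁻¹ * letter x) (letter x) := by
    refine gromov_pos_trans (h := a⁻¹) (by rw [gromov_comm]; omega) ?_
    rw [gromov_comm]
    exact gromov_pos_trans hx h0
  omega

/-- Geometrically, `q` is the projection of `1` to the axis of `b` and `d.norm` is the translation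
length. The word is peeled letter by letter from both ends. -/
theorem exists_conj_cycReduced (b : FreeGroup X) :
    ∃ q d : FreeGroup X, b = q * d * q⁻¹ ∧ CycReduced d ∧ b.norm = d.norm + 2 * q.norm := by
  induction hn : b.norm using Nat.strong_induction_on generalizing b with
  | _ n ih =>
    by_cases hb : CycReduced b
    · exact ⟨1, b, by group, hb, by simp [hn]⟩
    · have hb1 : b ≠ 1 := by
        rintro rfl
        exact hb (by simp [CycReduced, gromov, lcpLength])
      obtain ⟨x, hx⟩ := exists_letter hb1
      have h1 := norm_conj_letter_of_not_cycReduced hb hx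
      obtain ⟨q, d, hq, hd, hqd⟩ :=
        ih ((letter x)⁻¹ * b * letter x).norm (by omega) ((letter x)⁻¹ * b * letter x) rfl
      have hb' : b = (letter x * q) * d * (letter x * q)⁻¹ := by
        rw [show (letter x * q) * d * (letter x * q)⁻¹ = letter x * (q * d * q⁻¹) * (letter x)⁻¹
          by group, ← hq]
        group
      refine ⟨letter x * q, d, hb', hd, ?_⟩
      have h2 := FreeGroup.norm_mul_le (letter x) q
      have h3 := FreeGroup.norm_mul_le ((letter x * q) * d) (letter x * q)⁻¹
      have h4 := FreeGroup.norm_mul_le (letter x * q) d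
      have h5 := norm_letter x
      rw [FreeGroup.norm_inv_eq, ← hb'] at h3
      omega

/-- The length hypothesis says that nothing cancels at the two junctions. Since `d ^ k` starts and
ends like `d`, nothing cancels there for the power either. -/
theorem norm_conj_pow {q d : FreeGroup X} (hd : CycReduced d) (hd1 : d ≠ 1)
    (h : (q * d * q⁻¹).norm = d.norm + 2 * q.norm) {k : ℕ} (hk : k ≠ 0) :
    (q * d ^ k * q⁻¹).norm = k * d.norm + 2 * q.norm := by
  have key : ∀ d : FreeGroup X, CycReduced d → d ≠ 1 →
      (q * d * q⁻¹).norm = d.norm + 2 * q.norm → gromov q⁻¹ (d ^ k) = 0 := by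
    intro d hd hd1 h
    have h1 := FreeGroup.norm_mul_le (q * d) q⁻¹
    have h2 := norm_mul q d
    rw [FreeGroup.norm_inv_eq] at h1
    by_contra hne
    have h3 := hd.gromov_pow_pos hd1 hk
    rw [gromov_comm] at h3
    have := gromov_pos_trans (Nat.pos_of_ne_zero hne) h3
    omega
  have h1 := norm_conj_of_gromov_eq_zero (a := d ^ k) (g := q⁻¹)
    (fun h => hd1 ((pow_eq_one_iff_left hk).1 h)) (key d hd hd1 h) (by
      rw [← inv_pow]
      refine key d⁻¹ hd.inv (inv_ne_one.2 hd1) ?_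
      rw [FreeGroup.norm_inv_eq, ← h, ← FreeGroup.norm_inv_eq]
      congr 1
      group)
  rwa [inv_inv, FreeGroup.norm_inv_eq, hd.norm_pow] at h1

/-- In `a = q d q⁻¹` the tail contributes `2 |q|` to the length of every non-zero power; doubling
the exponent must double the length, so `q = 1`. -/
theorem CycReduced.of_pow {a : FreeGroup X} {k : ℕ} (hk : k ≠ 0) (h : CycReduced (a ^ k)) :
    CycReduced a := by
  by_cases ha : a = 1
  · rw [ha] at h ⊢; simpa using h
  obtain ⟨q, d, hq, hd, hqd⟩ := exists_conj_cycReduced a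
  have hd1 : d ≠ 1 := by
    rintro rfl
    exact ha (by rw [hq]; group)
  have hpow : ∀ k, a ^ k = q * d ^ k * q⁻¹ := fun k => by rw [hq, conj_pow]
  rw [hq] at hqd
  have h1 := norm_conj_pow hd hd1 hqd hk
  have h2 := norm_conj_pow hd hd1 hqd (k := k + k) (by omega)
  rw [cycReduced_iff, ← pow_add, hpow, hpow, h1, h2] at h
  have : q.norm = 0 := by linarith
  rw [FreeGroup.norm_eq_zero] at this
  subst this
  rw [hq]
  simpa using hd

theorem CycReduced.of_zpow {a : FreeGroup X} {k : ℤ} (hk : k ≠ 0) (h : CycReduced (a ^ k)) :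
    CycReduced a := by
  obtain ⟨n, rfl | rfl⟩ := k.eq_nat_or_neg
  · rw [zpow_natCast] at h
    exact h.of_pow (by simpa using hk)
  · rw [zpow_neg, zpow_natCast] at h
    have := h.inv
    rw [inv_inv] at this
    exact this.of_pow (by simpa using hk)

/-- A tail of the conjugate would leave a still shorter conjugate of `e`, against the minimality of
`e.norm`. -/
theorem CycReduced.conj_of_norm_le {e : FreeGroup X} (he : CycReduced e) {q : FreeGroup X}
    (h : (q⁻¹ * e * q).norm ≤ e.norm) : CycReduced (q⁻¹ * e * q) := by
  obtain ⟨r, f, hr, hf, hrf⟩ := exists_conj_cycReduced (q⁻¹ * e * q)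
  have h1 := he.norm_le (q * r)
  rw [show (q * r)⁻¹ * e * (q * r) = r⁻¹ * (q⁻¹ * e * q) * r by group, hr,
    show r⁻¹ * (r * f * r⁻¹) * r = f by group] at h1
  have h2 : r.norm = 0 := by omega
  rw [FreeGroup.norm_eq_zero] at h2
  subst h2
  rw [hr]
  simpa using hf

end Metric

/-! ### Displacement functions and the ping-pong estimate -/

section Metric

variable {X : Type u} [DecidableEq X]

theorem dist_mul_self (a g : FreeGroup X) : dist g (a * g) = (g⁻¹ * a * g).norm := by
  rw [dist, mul_assoc]

/-- Convexity of the displacement function of `a`. -/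
theorem norm_conj_le_of_between {x y z : FreeGroup X} (h : dist x y + dist y z = dist x z)
    (a : FreeGroup X) : (y⁻¹ * a * y).norm + 2 * dist x y ≤ (x⁻¹ * a * x).norm ∨
      (y⁻¹ * a * y).norm ≤ (z⁻¹ * a * z).norm := by
  simp only [← dist_mul_self]
  have h1 := dist_le_of_between h (a * y)
  have h2 := dist_le_of_between h (a⁻¹ * x)
  have h3 := dist_le_of_between h (a⁻¹ * z)
  have e : ∀ g k : FreeGroup X, dist g (a⁻¹ * k) = dist (a * g) k := fun g k => by
    rw [← dist_mul_left a g, mul_inv_cancel_left]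
  simp only [e] at h2 h3
  have h4 := dist_triangle (a * z) z x
  have h5 := dist_triangle (a * x) (a * z) z
  have h6 := dist_mul_left a x z
  have c1 := dist_comm (a * y) x
  have c2 := dist_comm (a * y) z
  have c3 := dist_comm (a * x) x
  have c4 := dist_comm (a * z) z
  have c5 := dist_comm z x
  omega

/-- If `d` moves along the axis of `e` by its translation length, then `d = e` or `d = e⁻¹`. -/
theorem eq_or_eq_inv_of_norm_conj_le {d e : FreeGroup X} (he : CycReduced e)
    (hn : d.norm = e.norm) (h : (d⁻¹ * e * d).norm ≤ e.norm) : d = e ∨ d = e⁻¹ := by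
  rw [← dist_mul_self] at h
  -- The distances from `d` to `e` and to `e⁻¹` have sum at most `2 |e|` by the first four-point
  -- inequality, and one of them is at least `2 |e|` by the second; so the other one vanishes.
  have h1 := four_point 1 d (e * d) e
  have h2 := four_point e⁻¹ 1 e d
  have e1 : dist (e * d) e = d.norm := by
    have := dist_mul_left e d 1
    rwa [mul_one, dist_one_right] at this
  have e2 : dist e⁻¹ e = 2 * e.norm := by
    rw [dist, inv_inv, ← cycReduced_iff]; exact he
  have e3 : dist e⁻¹ d = dist 1 (e * d) := by
    rw [← dist_mul_left e, mul_inv_cancel]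
  have e4 := dist_comm d e
  rw [e1, dist_one_left e, dist_one_left d] at h1
  rw [e2, e3, dist_one_left e, dist_one_left d, dist_one_right, FreeGroup.norm_inv_eq] at h2
  rcases Nat.eq_zero_or_pos (dist d e) with h0 | h0
  · exact Or.inl (eq_of_dist_eq_zero h0)
  · right
    have h3 : dist e⁻¹ d = 0 := by omega
    exact (eq_of_dist_eq_zero h3).symm

/-- The ping-pong estimate: a point that is at least as close to the axis of `a` as to the axis of
its conjugate `b` is moved by powers of `b` to a point that is closer to the axis of `b`. -/
theorem norm_lt_norm_conj_pow {a b k : FreeGroup X} (hk : b = k * a * k⁻¹) (ha : a ≠ 1)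
    (h1 : a ≠ b) (h2 : a ≠ b⁻¹) (hab : a.norm ≤ b.norm) {j : ℕ} (hj : j ≠ 0) :
    b.norm < ((b ^ j)⁻¹ * a * b ^ j).norm := by
  by_contra hle
  rw [not_lt] at hle
  -- Here `q` is the projection of `1` to the axis of `b`, and `m = b ^ j * s` below is the
  -- projection of `b ^ j` to the axis of `a`. As the translation lengths `|d|` and `|e|` agree,
  -- `hle` amounts to `|s| ≤ |q|`.
  obtain ⟨q, d, hq, hd, hqd⟩ := exists_conj_cycReduced b
  obtain ⟨s, e, hs, he, hse⟩ := exists_conj_cycReduced ((b ^ j)⁻¹ * a * b ^ j)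
  have hd1 : d ≠ 1 := by
    rintro rfl
    refine ha ?_
    have : b = 1 := by rw [hq]; group
    rw [this] at hk
    calc a = k⁻¹ * (k * a * k⁻¹) * k := by group
      _ = 1 := by rw [← hk]; group
  obtain ⟨m, hm⟩ : ∃ m, m = b ^ j * s := ⟨_, rfl⟩
  have ha_e : a = m * e * m⁻¹ := by
    calc a = b ^ j * ((b ^ j)⁻¹ * a * b ^ j) * (b ^ j)⁻¹ := by group
      _ = _ := by rw [hs, hm]; group
  have hn : d.norm = e.norm := by
    refine le_antisymm ?_ ?_
    · have h3 := hd.norm_le (q⁻¹ * k * m)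
      rwa [show (q⁻¹ * k * m)⁻¹ * d * (q⁻¹ * k * m) = m⁻¹ * (k⁻¹ * (q * d * q⁻¹) * k) * m by group,
        ← hq, hk, ha_e,
        show m⁻¹ * (k⁻¹ * (k * (m * e * m⁻¹) * k⁻¹) * k) * m = e by group] at h3
    · have h3 := he.norm_le (m⁻¹ * k⁻¹ * q)
      rwa [show (m⁻¹ * k⁻¹ * q)⁻¹ * e * (m⁻¹ * k⁻¹ * q) = q⁻¹ * (k * (m * e * m⁻¹) * k⁻¹) * q by group,
        ← ha_e, ← hk, hq, show q⁻¹ * (q * d * q⁻¹) * q = d by group] at h3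
  have hnpos := norm_pos hd1
  have hma : (m⁻¹ * a * m).norm = e.norm := by rw [ha_e]; group
  have hbj : ∀ i, b ^ i = q * d ^ i * q⁻¹ := fun i => by rw [hq, conj_pow]
  have hqd' : (q * d * q⁻¹).norm = d.norm + 2 * q.norm := by rw [← hq, hqd]
  have hbn : (b ^ j).norm = j * d.norm + 2 * q.norm := by
    rw [hbj]; exact norm_conj_pow hd hd1 hqd' hj
  have hmb : dist (b ^ j) m = s.norm := by rw [dist, hm, inv_mul_cancel_left]
  obtain ⟨i, rfl⟩ := Nat.exists_eq_add_one_of_ne_zero hj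
  have hmul : (i + 1) * d.norm = i * d.norm + d.norm := by ring
  -- The point `m` is within `|q|` of `b ^ j`, so the geodesic from `1` to `m` follows the one to `b
  -- ^ j` at least as far as the axis of `b` does. The number `l` is the position along this axis:
  -- `0` for `q` and `|d|` for `q * d`.
  have hbetween : ∀ (y : FreeGroup X) (l : ℕ), l ≤ d.norm → y.norm ≤ q.norm + l →
      dist y (b ^ (i + 1)) + l ≤ (i + 1) * d.norm + q.norm → y.norm + dist y m = m.norm := by
    intro y l hl hy1 hy2
    have h3 := four_point 1 y (b ^ (i + 1)) m
    have h4 := dist_triangle 1 y m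
    have h5 := dist_triangle 1 m y
    rw [dist_comm m y] at h5
    simp only [dist_one_left] at h3 h4 h5
    have h6 := dist_comm m (b ^ (i + 1))
    omega
  have hq1 : q.norm + dist q m = m.norm := by
    refine hbetween q 0 (by omega) (by omega) ?_
    have : q⁻¹ * b ^ (i + 1) = d ^ (i + 1) * q⁻¹ := by rw [hbj]; group
    rw [dist, this]
    have h3 := FreeGroup.norm_mul_le (d ^ (i + 1)) q⁻¹
    rw [hd.norm_pow, FreeGroup.norm_inv_eq] at h3
    omega
  have hq2 : (q * d).norm + dist (q * d) m = m.norm := by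
    refine hbetween (q * d) d.norm le_rfl (FreeGroup.norm_mul_le _ _) ?_
    have : (q * d)⁻¹ * b ^ (i + 1) = d ^ i * q⁻¹ := by rw [hbj, pow_succ']; group
    rw [dist, this]
    have h3 := FreeGroup.norm_mul_le (d ^ i) q⁻¹
    rw [hd.norm_pow, FreeGroup.norm_inv_eq] at h3
    omega
  have hqd2 : q.norm ≤ (q * d).norm := by
    have h3 := FreeGroup.norm_mul_le (q * d) q⁻¹
    rw [FreeGroup.norm_inv_eq] at h3
    omega
  -- The displacement of `a` is at most `|d| + 2 |q|` at `1` and minimal at `m`. Convexity makes it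
  -- minimal at `q` and at `q * d`, so the axes share a segment of length `|d|`, which forces `b =
  -- a` or `b = a⁻¹`.
  have hc1 := norm_conj_le_of_between (x := 1) (by simpa only [dist_one_left] using hq1) a
  have hc2 := norm_conj_le_of_between (x := 1) (by simpa only [dist_one_left] using hq2) a
  simp only [dist_one_left, inv_one, one_mul, mul_one] at hc1 hc2
  have hmin : e.norm ≤ (q⁻¹ * a * q).norm := by
    have := he.norm_le (m⁻¹ * q)
    refine this.trans (le_of_eq (congrArg _ ?_))
    rw [ha_e]
    group
  have hcr : CycReduced (q⁻¹ * a * q) := by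
    have h3 : (m⁻¹ * q)⁻¹ * e * (m⁻¹ * q) = q⁻¹ * a * q := by rw [ha_e]; group
    rw [← h3]
    exact he.conj_of_norm_le (by rw [h3]; omega)
  have h3 := eq_or_eq_inv_of_norm_conj_le (d := d) hcr (by omega) (by
    rw [show d⁻¹ * (q⁻¹ * a * q) * d = (q * d)⁻¹ * a * (q * d) by group]
    omega)
  rcases h3 with h3 | h3
  · exact h1 (by rw [hq, h3]; group)
  · exact h2 (by rw [hq, h3]; group)

theorem norm_lt_norm_conj_zpow {a b k : FreeGroup X} (hk : b = k * a * k⁻¹) (ha : a ≠ 1)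
    (h1 : a ≠ b) (h2 : a ≠ b⁻¹) (hab : a.norm ≤ b.norm) {j : ℤ} (hj : j ≠ 0) :
    b.norm < ((b ^ j)⁻¹ * a * b ^ j).norm := by
  obtain ⟨n, rfl | rfl⟩ := j.eq_nat_or_neg
  · rw [zpow_natCast]
    exact norm_lt_norm_conj_pow hk ha h1 h2 hab (by simpa using hj)
  · have h3 := norm_lt_norm_conj_pow (a := a⁻¹) (b := b⁻¹) (k := k) (by rw [hk]; group)
      (inv_ne_one.2 ha) (by simpa using h1) (by simpa [inv_eq_iff_eq_inv] using h2)
      (by simpa only [FreeGroup.norm_inv_eq] using hab) (j := n) (by simpa using hj)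
    rw [zpow_neg, zpow_natCast, ← inv_pow]
    rw [FreeGroup.norm_inv_eq] at h3
    refine h3.trans_eq ?_
    rw [← FreeGroup.norm_inv_eq]
    congr 1
    group

/-! ### Alternating products and the return of axis points -/

/-- Alternating products of powers of `c` and `w`; the Boolean tells whether the product is a power
of `c` or starts with a power of `c`. -/
inductive AltProd {G : Type u} [Group G] (c w : G) : Bool → G → Prop
  | pow (i : ℤ) : AltProd c w true (c ^ i)
  | left (i : ℤ) (hi : i ≠ 0) (t : G) : AltProd c w false t → AltProd c w true (c ^ i * t)
  | right (i : ℤ) (hi : i ≠ 0) (t : G) : AltProd c w true t → AltProd c w false (w ^ i * t)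

/-- Only the existence of such a form is needed, so it suffices to absorb generators from the left
and merge exponents, dropping a syllable when its exponent becomes zero. -/
theorem exists_altProd {G : Type u} [Group G] {c w y : G} (hy : y ∈ Subgroup.closure {c, w}) :
    ∃ s, AltProd c w s y := by
  have hc : ∀ (i : ℤ) (s : Bool) (t : G), i ≠ 0 → AltProd c w s t →
      ∃ s, AltProd c w s (c ^ i * t) := by
    intro i s t hi ht
    cases ht with
    | pow j => exact ⟨true, by rw [← zpow_add]; exact AltProd.pow _⟩
    | left j hj t ht =>
      rw [← mul_assoc, ← zpow_add]
      by_cases h0 : i + j = 0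
      · exact ⟨false, by rw [h0, zpow_zero, one_mul]; exact ht⟩
      · exact ⟨true, AltProd.left _ h0 _ ht⟩
    | right j hj t ht => exact ⟨true, AltProd.left i hi _ (AltProd.right j hj t ht)⟩
  have hw : ∀ (i : ℤ) (s : Bool) (t : G), i ≠ 0 → AltProd c w s t →
      ∃ s, AltProd c w s (w ^ i * t) := by
    intro i s t hi ht
    cases ht with
    | pow j => exact ⟨false, AltProd.right i hi _ (AltProd.pow j)⟩
    | left j hj t ht => exact ⟨false, AltProd.right i hi _ (AltProd.left j hj t ht)⟩
    | right j hj t ht =>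
      rw [← mul_assoc, ← zpow_add]
      by_cases h0 : i + j = 0
      · exact ⟨true, by rw [h0, zpow_zero, one_mul]; exact ht⟩
      · exact ⟨false, AltProd.right _ h0 _ ht⟩
  induction hy using Subgroup.closure_induction_left with
  | one => exact ⟨true, by simpa using AltProd.pow (c := c) (w := w) 0⟩
  | mul_left x hx y _ ih =>
    obtain ⟨s, hs⟩ := ih
    rcases hx with rfl | rfl
    · simpa using hc 1 s y one_ne_zero hs
    · simpa using hw 1 s y one_ne_zero hs
  | inv_mul_cancel x hx y _ ih =>
    obtain ⟨s, hs⟩ := ih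
    rcases hx with rfl | rfl
    · simpa using hc (-1) s y (by simp) hs
    · simpa using hw (-1) s y (by simp) hs

/-- The orbit of a point of the axis of `c` under `⟨c, w⟩`, for a conjugate `w` of `c`, meets this
axis only in the orbit under `⟨c⟩`. -/
theorem mem_zpowers_of_cycReduced {c w k y : FreeGroup X} (hc : CycReduced c) (hc1 : c ≠ 1)
    (hw : w = k * c * k⁻¹) (hy : y ∈ Subgroup.closure {c, w}) (hcy : CycReduced (y⁻¹ * c * y)) :
    y ∈ Subgroup.zpowers c := by
  by_cases hw1 : c = w
  · subst hw1
    rwa [Set.pair_eq_singleton, ← Subgroup.zpowers_eq_closure] at hy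
  by_cases hw2 : c = w⁻¹
  · have hle : Subgroup.closure {c, w} ≤ Subgroup.zpowers c := by
      rw [Subgroup.closure_le]
      rintro _ (rfl | rfl)
      · exact Subgroup.mem_zpowers _
      · rw [hw2]; simp
    exact hle hy
  have hmin_c : ∀ t : FreeGroup X, c.norm ≤ (t⁻¹ * c * t).norm := hc.norm_le
  have hmin_w : ∀ t : FreeGroup X, c.norm ≤ (t⁻¹ * w * t).norm := fun t => by
    refine (hc.norm_le (k⁻¹ * t)).trans (le_of_eq (congrArg _ ?_))
    rw [hw]; group
  -- The ping-pong estimate at the base point, transported to the point `t` by conjugating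
  -- everything with `t`.
  have step : ∀ (a b h t : FreeGroup X), b = h * a * h⁻¹ → a ≠ 1 → a ≠ b → a ≠ b⁻¹ →
      (t⁻¹ * a * t).norm ≤ (t⁻¹ * b * t).norm → ∀ j : ℤ, j ≠ 0 →
      ((b ^ j * t)⁻¹ * b * (b ^ j * t)).norm < ((b ^ j * t)⁻¹ * a * (b ^ j * t)).norm := by
    intro a b h t hb ha h1 h2 hle j hj
    have hconj : ∀ x, t⁻¹ * x * t = MulAut.conj t⁻¹ x := fun x => by simp
    have := norm_lt_norm_conj_zpow (a := t⁻¹ * a * t) (b := t⁻¹ * b * t) (k := t⁻¹ * h * t)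
      (by rw [hb]; group) (fun h0 => ha (by
        rw [hconj] at h0; exact (MulEquiv.map_eq_one_iff _).1 h0))
      (fun h0 => h1 (by rw [hconj, hconj] at h0; exact (MulAut.conj t⁻¹).injective h0))
      (fun h0 => h2 (by
        rw [hconj, hconj, ← map_inv] at h0; exact (MulAut.conj t⁻¹).injective h0)) hle hj
    convert this using 2
    · group
    · rw [hconj b, ← map_zpow]
      simp only [MulAut.conj_apply]
      group
  -- The leftmost syllable decides which axis is nearer. A product that starts with a power of `c`
  -- but is not one keeps the displacement of `c` at its tail, which exceeds that of `w` there and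
  -- hence the minimum `|c|`.
  have main : ∀ s y, AltProd c w s y →
      (s = true → (y⁻¹ * c * y).norm ≤ (y⁻¹ * w * y).norm ∧
        (y ∈ Subgroup.zpowers c ∨ c.norm < (y⁻¹ * c * y).norm)) ∧
      (s = false → (y⁻¹ * w * y).norm < (y⁻¹ * c * y).norm) := by
    intro s y h
    induction h with
    | pow i =>
      refine ⟨fun _ => ⟨?_, Or.inl (Subgroup.zpow_mem_zpowers c i)⟩, by simp⟩
      have : (c ^ i)⁻¹ * c * c ^ i = c := by group
      rw [this]
      exact hmin_w _
    | left i hi t _ ih =>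
      refine ⟨fun _ => ⟨(step w c k⁻¹ t (by rw [hw]; group) ?_ (Ne.symm hw1) ?_
        (ih.2 rfl).le i hi).le, Or.inr ?_⟩, by simp⟩
      · rintro rfl
        exact hc1 (by simpa using hw.symm)
      · rintro rfl
        exact hw2 (by simp)
      · have : (c ^ i * t)⁻¹ * c * (c ^ i * t) = t⁻¹ * c * t := by group
        rw [this]
        exact (hmin_w t).trans_lt (ih.2 rfl)
    | right i hi t _ ih =>
      exact ⟨by simp, fun _ => step c w k t hw hc1 hw1 hw2 (ih.1 rfl).1 i hi⟩
  -- The point `y` lies on the axis of `c`, where the displacement is minimal; this excludes every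
  -- form except a power of `c`.
  have hnorm : (y⁻¹ * c * y).norm ≤ c.norm := by
    have := hcy.norm_le y⁻¹
    rwa [inv_inv, show y * (y⁻¹ * c * y) * y⁻¹ = c by group] at this
  obtain ⟨s, hs⟩ := exists_altProd hy
  cases s with
  | true =>
    rcases ((main _ _ hs).1 rfl).2 with h | h
    · exact h
    · omega
  | false =>
    have h1 := (main _ _ hs).2 rfl
    have h2 := hmin_w y
    omega

end Metric

/-! ## Core edges and core vertices of the covers of the rose -/

theorem isReduced_map_label {X : Type u} {Γ : LGraph.{u, v} X} (hΓ : Γ.IsFolded)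
    {p : List Γ.E} {x y : Γ.V} (hp : Γ.IsPath p x y) (hr : Γ.IsReduced p) : FreeGroup.IsReduced (p.map Γ.label) := by
  induction p generalizing x with
  | nil => exact List.isChain_nil
  | cons e p ih =>
    cases p with
    | nil => exact List.isChain_singleton _
    | cons f p =>
      obtain ⟨h1, h2⟩ := List.isChain_cons_cons.1 hr
      refine List.isChain_cons_cons.2 ⟨fun h => ?_, ih hp.2 h2⟩
      by_contra hne
      refine h1 (hΓ _ _ hp.2.1 ?_)
      rw [Γ.label_bar]
      refine Prod.ext h.symm ?_
      revert hne
      simp only [inv]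
      cases (Γ.label e).2 <;> cases (Γ.label f).2 <;> simp

section Hull

variable {X : Type u} [DecidableEq X]

theorem isReduced_of_norm_mk_eq {L : List (X × Bool)} (h : (FreeGroup.mk L).norm = L.length) :
    FreeGroup.IsReduced L := by
  rw [FreeGroup.isReduced_iff_reduce_eq]
  refine List.Sublist.eq_of_length (FreeGroup.Red.sublist FreeGroup.reduce.red) ?_
  rwa [FreeGroup.norm, FreeGroup.toWord_mk] at h

theorem exists_letter_dist {g h : FreeGroup X} (hne : g ≠ h) :
    ∃ x, dist (g * letter x) h + 1 = dist g h := by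
  obtain ⟨x, hx⟩ := exists_letter (g := g⁻¹ * h) fun h0 => hne (inv_mul_eq_one.1 h0)
  have h1 := norm_inv_mul (letter x) (g⁻¹ * h)
  have h2 := gromov_letter_le x (g⁻¹ * h)
  rw [norm_letter] at h1
  refine ⟨x, ?_⟩
  rw [dist, mul_inv_rev, mul_assoc, dist]
  omega

theorem dist_mul_letter (g : FreeGroup X) (x : X × Bool) : dist g (g * letter x) = 1 := by
  rw [dist, inv_mul_cancel_left, norm_letter]

/-- The cover is the Cayley tree modulo `H`. Closed reduced paths at its base point lift to
geodesics between elements of `H`, and conversely. -/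
theorem cover_isCoreEdge_iff {H : Subgroup (FreeGroup X)} {g : FreeGroup X} {x : X × Bool} :
    (cover H).IsCoreEdge (RCoset.mk H g, x) ↔
      ∃ h₁ ∈ H, ∃ h₂ ∈ H, dist h₁ g + 1 + dist (g * letter x) h₂ = dist h₁ h₂ := by
  constructor
  · rintro ⟨p, hp, hr, he⟩
    have hL' := isReduced_map_label (cover_folded H) hp hr
    obtain ⟨s, t, rfl⟩ := List.append_of_mem he
    have hL : FreeGroup.IsReduced (s.map (cover H).label ++ x :: t.map (cover H).label) := by
      rw [List.map_append] at hL'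
      exact hL'
    obtain ⟨y, hs, ht⟩ := Graph.isPath_split hp
    have h1 := cover_isPath hs
    have h2 : RCoset.mk H g = y := ht.1
    have h3 := cover_isPath ht.2
    have h4 : RCoset.mk H g = RCoset.mk H (1 * (cover H).pathLabel s) := h2.trans h1
    have h5 : RCoset.mk H 1 = RCoset.mk H (g * letter x * (cover H).pathLabel t) := h3
    rw [RCoset.mk_eq] at h4 h5
    rw [inv_one, mul_one] at h5
    rw [one_mul] at h4
    refine ⟨g * ((cover H).pathLabel s)⁻¹, by simpa using H.inv_mem h4, _, h5, ?_⟩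
    have e1 : (g * ((cover H).pathLabel s)⁻¹)⁻¹ * g = FreeGroup.mk (s.map (cover H).label) := by
      simp [LGraph.pathLabel]
    have e2 : (g * letter x)⁻¹ * (g * letter x * (cover H).pathLabel t) =
        FreeGroup.mk (t.map (cover H).label) := inv_mul_cancel_left _ _
    have e3 : (g * ((cover H).pathLabel s)⁻¹)⁻¹ * (g * letter x * (cover H).pathLabel t) =
        FreeGroup.mk (s.map (cover H).label ++ x :: t.map (cover H).label) := by
      rw [show (g * ((cover H).pathLabel s)⁻¹)⁻¹ * (g * letter x * (cover H).pathLabel t) =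
        (cover H).pathLabel s * (letter x * (cover H).pathLabel t) by group]
      simp [LGraph.pathLabel, letter, FreeGroup.mul_mk]
    rw [dist, dist, dist, e1, e2, e3, norm_mk_of_isReduced hL,
      norm_mk_of_isReduced (hL.infix ⟨[], x :: t.map (cover H).label, by simp⟩),
      norm_mk_of_isReduced (hL.infix ⟨s.map (cover H).label ++ [x], [], by simp⟩)]
    simp only [List.length_append, List.length_cons]
    omega
  · rintro ⟨h₁, hh₁, h₂, hh₂, hd⟩
    obtain ⟨w₁, hw₁⟩ : ∃ w, w = (h₁⁻¹ * g).toWord := ⟨_, rfl⟩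
    obtain ⟨w₂, hw₂⟩ : ∃ w, w = ((g * letter x)⁻¹ * h₂).toWord := ⟨_, rfl⟩
    have hd' : w₁.length + 1 + w₂.length = (h₁⁻¹ * h₂).norm := by rw [hw₁, hw₂]; exact hd
    have hmk : FreeGroup.mk (w₁ ++ x :: w₂) = h₁⁻¹ * h₂ := by
      have : FreeGroup.mk (w₁ ++ x :: w₂) = FreeGroup.mk w₁ * (letter x * FreeGroup.mk w₂) := by
        simp [letter, FreeGroup.mul_mk]
      rw [this, hw₁, hw₂, FreeGroup.mk_toWord, FreeGroup.mk_toWord]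
      group
    have hL : FreeGroup.IsReduced (w₁ ++ x :: w₂) := by
      refine isReduced_of_norm_mk_eq ?_
      rw [hmk, List.length_append, List.length_cons]
      omega
    obtain ⟨p, hpL, hp⟩ := cover_exists_path H (w₁ ++ x :: w₂) (RCoset.mk H h₁)
    rw [hmk, RCoset.smul_mk, mul_inv_cancel_left,
      (RCoset.mk_eq (g := h₁) (g' := 1)).2 (by simpa using H.inv_mem hh₁),
      (RCoset.mk_eq (g := h₂) (g' := 1)).2 (by simpa using H.inv_mem hh₂)] at hp
    have hr : (cover H).IsReduced p := by
      rw [← hpL, FreeGroup.IsReduced, List.isChain_map] at hL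
      refine hL.imp ?_
      rintro a b hab rfl
      simpa [cover, inv] using hab rfl
    refine ⟨p, hp, hr, ?_⟩
    obtain ⟨p₁, p', rfl, hp₁, hp'⟩ := List.map_eq_append_iff.1 hpL
    obtain ⟨e, p₂, rfl, he, hp₂⟩ := List.map_eq_cons_iff.1 hp'
    obtain ⟨y, hy1, hy2⟩ := Graph.isPath_split hp
    have h3 := cover_isPath hy1
    rw [LGraph.pathLabel, hp₁, hw₁, FreeGroup.mk_toWord, RCoset.smul_mk, one_mul] at h3
    have h4 : RCoset.mk H (h₁⁻¹ * g) = RCoset.mk H g := by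
      rw [RCoset.mk_eq]; simpa using hh₁
    have h5 : e = (RCoset.mk H g, x) := Prod.ext (hy2.1.trans (h3.trans h4)) he
    rw [← h5]
    simp

/-! ### The convex hull of a subgroup and the axes inside it -/

/-- The convex hull of `H` in the Cayley tree. -/
def InHull (H : Subgroup (FreeGroup X)) (g : FreeGroup X) : Prop :=
  ∃ h₁ ∈ H, ∃ h₂ ∈ H, dist h₁ g + dist g h₂ = dist h₁ h₂

theorem cover_isCoreVertex_iff {H : Subgroup (FreeGroup X)} {g : FreeGroup X} :
    (cover H).IsCoreVertex (RCoset.mk H g) ↔ InHull H g := by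
  constructor
  · rintro (h | ⟨⟨c, x⟩, he, hc⟩)
    · have h1 : g ∈ H := by
        have : RCoset.mk H 1 = RCoset.mk H g := h.symm
        simpa using RCoset.mk_eq.1 this
      exact ⟨g, h1, g, h1, by simp [dist]⟩
    · have hc' : c = RCoset.mk H g := hc
      subst hc'
      obtain ⟨h₁, hh₁, h₂, hh₂, hd⟩ := cover_isCoreEdge_iff.1 he
      refine ⟨h₁, hh₁, h₂, hh₂, ?_⟩
      have h1 := dist_triangle g (g * letter x) h₂
      have h2 := dist_triangle h₁ g h₂
      have h3 := dist_mul_letter g x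
      omega
  · rintro ⟨h₁, hh₁, h₂, hh₂, hd⟩
    by_cases hg : g = h₂
    · left
      subst hg
      exact RCoset.mk_eq.2 (by simpa using H.inv_mem hh₂)
    · right
      obtain ⟨x, hx⟩ := exists_letter_dist hg
      exact ⟨(RCoset.mk H g, x), cover_isCoreEdge_iff.2 ⟨h₁, hh₁, h₂, hh₂, by omega⟩, rfl⟩

theorem dist_letter_cases (p g : FreeGroup X) (x : X × Bool) :
    dist p (g * letter x) = dist p g + 1 ∨ dist p g = dist p (g * letter x) + 1 := by
  have h1 := norm_inv_mul (g⁻¹ * p) (letter x)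
  rw [norm_letter, show (g⁻¹ * p)⁻¹ * letter x = p⁻¹ * (g * letter x) by group] at h1
  have h2 : (g⁻¹ * p).norm = dist p g := dist_comm g p
  have h3 := gromov_letter_le x (g⁻¹ * p)
  rw [gromov_comm] at h3
  rw [dist]
  omega

/-- Edges of the tree with both end points in the hull of `H` are core edges. -/
theorem cover_isCoreEdge_of_inHull {H : Subgroup (FreeGroup X)} {g : FreeGroup X} {x : X × Bool}
    (h : InHull H g) (h' : InHull H (g * letter x)) :
    (cover H).IsCoreEdge (RCoset.mk H g, x) := by
  obtain ⟨p₁, hp₁, p₂, hp₂, hd⟩ := h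
  obtain ⟨p₃, hp₃, p₄, hp₄, hd'⟩ := h'
  -- The edge cuts the tree into two halves. A vertex between two elements of `H` has one of them on
  -- its own side, so both halves meet `H`, and a geodesic across the edge exists.
  have h1 : ∃ p ∈ H, dist p (g * letter x) = dist p g + 1 := by
    rcases dist_letter_cases p₁ g x with h | h
    · exact ⟨p₁, hp₁, h⟩
    rcases dist_letter_cases p₂ g x with h2 | h2
    · exact ⟨p₂, hp₂, h2⟩
    have := dist_triangle p₁ (g * letter x) p₂
    have := dist_comm p₂ g
    have := dist_comm p₂ (g * letter x)
    omega
  have h2 : ∃ p ∈ H, dist p g = dist p (g * letter x) + 1 := by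
    rcases dist_letter_cases p₃ g x with h3 | h3
    swap
    · exact ⟨p₃, hp₃, h3⟩
    rcases dist_letter_cases p₄ g x with h4 | h4
    swap
    · exact ⟨p₄, hp₄, h4⟩
    have := dist_triangle p₃ g p₄
    have := dist_comm p₄ g
    have := dist_comm p₄ (g * letter x)
    omega
  obtain ⟨p, hp, h3⟩ := h1
  obtain ⟨q, hq, h4⟩ := h2
  refine cover_isCoreEdge_iff.2 ⟨p, hp, q, hq, ?_⟩
  have h5 := four_point p g (g * letter x) q
  have h6 := dist_triangle p g q
  have h7 := dist_triangle g (g * letter x) q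
  have h8 := dist_mul_letter g x
  have h9 := dist_comm q g
  have h10 := dist_comm (g * letter x) q
  have h11 := dist_comm (g * letter x) g
  omega

/-- The union of the axes of the non-trivial elements of `H`. -/
def OnAxis (H : Subgroup (FreeGroup X)) (g : FreeGroup X) : Prop :=
  ∃ h ∈ H, h ≠ 1 ∧ CycReduced (g⁻¹ * h * g)

theorem OnAxis.mul_left {H : Subgroup (FreeGroup X)} {g k : FreeGroup X} (hg : OnAxis H g)
    (hk : k ∈ H) : OnAxis H (k * g) := by
  obtain ⟨h, hh, h1, hc⟩ := hg
  refine ⟨k * h * k⁻¹, H.mul_mem (H.mul_mem hk hh) (H.inv_mem hk), by simpa using h1, ?_⟩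
  rwa [show (k * g)⁻¹ * (k * h * k⁻¹) * (k * g) = g⁻¹ * h * g by group]

theorem OnAxis.congr {H : Subgroup (FreeGroup X)} {g g' : FreeGroup X} (hg : OnAxis H g)
    (h : RCoset.mk H g = RCoset.mk H g') : OnAxis H g' := by
  have := hg.mul_left (RCoset.mk_eq.1 h)
  rwa [inv_mul_cancel_right] at this

/-- The translates of `g` by `h ^ N` and `h ^ (-N)` lie on the axis at distance `N |c|` on opposite
sides of `g`, and the elements `h ^ N`, `h ^ (-N)` of `H` are within `|g|` of them. With `N = |g| +
1` the point `g` lies between these elements. -/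
theorem OnAxis.inHull {H : Subgroup (FreeGroup X)} {g : FreeGroup X} (hg : OnAxis H g) :
    InHull H g := by
  obtain ⟨h, hh, h1, hc⟩ := hg
  set c := g⁻¹ * h * g with hcdef
  have hc1 : c ≠ 1 := fun h0 => h1 (by
    have : h = g * c * g⁻¹ := by rw [hcdef]; group
    rw [this, h0]; group)
  have hn := norm_pos hc1
  have hpow : ∀ i : ℕ, g⁻¹ * h ^ i * g = c ^ i := fun i => by
    have : c = MulAut.conj g⁻¹ h := by simp [hcdef]
    rw [this, ← map_pow]
    simp
  set N := g.norm + 1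
  have hN : g.norm < N * c.norm := by
    have : N * 1 ≤ N * c.norm := Nat.mul_le_mul_left _ hn
    omega
  set k := h ^ N with hk
  have d1 : dist (k⁻¹ * g) g = N * c.norm := by
    rw [dist, ← hc.norm_pow, ← hpow, ← hk]; congr 1; group
  have d2 : dist g (k * g) = N * c.norm := by
    rw [dist, ← hc.norm_pow, ← hpow, ← mul_assoc]
  have d3 : dist (k⁻¹ * g) (k * g) = 2 * (N * c.norm) := by
    rw [dist, ← mul_assoc, two_mul, ← Nat.add_mul, ← hc.norm_pow, ← hpow, pow_add, ← hk]
    congr 1; group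
  have d4 : dist (k * g) k = g.norm := by
    have := dist_mul_left k g 1
    rwa [mul_one, dist_one_right] at this
  have d5 : dist (k⁻¹ * g) k⁻¹ = g.norm := by
    have := dist_mul_left k⁻¹ g 1
    rwa [mul_one, dist_one_right] at this
  refine ⟨k⁻¹, H.inv_mem (H.pow_mem hh _), k, H.pow_mem hh _, ?_⟩
  have t1 := dist_triangle g k (k * g)
  have t2 := dist_triangle (k⁻¹ * g) k⁻¹ g
  have c1 := dist_comm k (k * g)
  have c2 := dist_comm g k⁻¹
  have f1 := four_point (k⁻¹ * g) g (k * g) k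
  have f2 := four_point k k⁻¹ (k⁻¹ * g) g
  have c3 := dist_comm k (k⁻¹ * g)
  have c4 := dist_comm k⁻¹ (k⁻¹ * g)
  have c5 := dist_comm g (k⁻¹ * g)
  have t3 := dist_triangle k⁻¹ g k
  have c6 := dist_comm k g
  have c7 := dist_comm k k⁻¹
  omega

/-- The neighbour on the axis. -/
theorem onAxis_mul_letter {H : Subgroup (FreeGroup X)} {g h : FreeGroup X} {x : X × Bool}
    (hh : h ∈ H) (h1 : h ≠ 1) (hc : CycReduced (g⁻¹ * h * g))
    (hx : 0 < gromov (letter x) (g⁻¹ * h * g)) : OnAxis H (g * letter x) := by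
  refine ⟨h, hh, h1, ?_⟩
  have e : (g * letter x)⁻¹ * h * (g * letter x) = (letter x)⁻¹ * (g⁻¹ * h * g) * letter x := by
    group
  have h2 := norm_inv_mul (letter x) (g⁻¹ * h * g)
  have h3 := gromov_letter_le x (g⁻¹ * h * g)
  -- The neighbour lies between `g` and `h * g`, where the displacement of `h` is minimal, so
  -- convexity applies.
  have hb : dist g (g * letter x) + dist (g * letter x) (h * g) = dist g (h * g) := by
    rw [norm_letter] at h2
    rw [dist_mul_letter, dist_mul_self, dist,
      show (g * letter x)⁻¹ * (h * g) = (letter x)⁻¹ * (g⁻¹ * h * g) by group]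
    omega
  have h4 := norm_conj_le_of_between hb h
  rw [show (h * g)⁻¹ * h * (h * g) = g⁻¹ * h * g by group] at h4
  rw [e] at h4 ⊢
  exact hc.conj_of_norm_le (by omega)

end Hull

/-! ## Trimming -/

section Trim

variable {X : Type u} [DecidableEq X]

theorem CycReduced.not_gromov_pos {c : FreeGroup X} (hc : CycReduced c) {x : X × Bool}
    (h1 : 0 < gromov (letter x) c) (h2 : 0 < gromov (letter x) c⁻¹) : False := by
  rw [gromov_comm] at h1
  have := gromov_pos_trans h1 h2
  rw [CycReduced] at hc
  omega

/-- An axis leaves each of its points in two different directions, and only one of them can be the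
exceptional edge of the trimming step; so no point of an axis is ever the first to go. -/
theorem not_onAxis_of_isTrimmed {H : Subgroup (FreeGroup X)} {x : (Gam H).V}
    (hx : (Gam H).IsTrimmed x) {g : FreeGroup X} (hg : RCoset.mk H g = x.1) : ¬ OnAxis H g := by
  induction hx generalizing g with
  | intro e h ih =>
    intro hax
    have key : ∀ y, OnAxis H (g * letter y) → e.1.2 = y := by
      intro y hy
      by_contra hne
      have he : (cover H).IsCoreEdge (RCoset.mk H g, y) :=
        cover_isCoreEdge_of_inHull hax.inHull hy.inHull
      exact ih ⟨(RCoset.mk H g, y), he⟩ (Subtype.ext hg)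
        (fun h0 => hne (congrArg (fun t => t.1.2) h0).symm) (g := g * letter y) rfl hy
    obtain ⟨k, hk, hk1, hc⟩ := hax
    have hc1 : g⁻¹ * k * g ≠ 1 := fun h0 => hk1 (by
      have : k = g * (g⁻¹ * k * g) * g⁻¹ := by group
      rw [this, h0]; group)
    have einv : g⁻¹ * k⁻¹ * g = (g⁻¹ * k * g)⁻¹ := by group
    obtain ⟨y, hy⟩ := exists_letter hc1
    obtain ⟨z, hz⟩ := exists_letter (inv_ne_one.2 hc1)
    have h1 := key y (onAxis_mul_letter hk hk1 hc hy)
    have h2 := key z (onAxis_mul_letter (H.inv_mem hk) (inv_ne_one.2 hk1)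
      (by rw [einv]; exact hc.inv) (by rwa [einv]))
    rw [← h1] at hy
    rw [← h2] at hz
    exact hc.not_gromov_pos hy hz

/-- The product of two non-cyclically reduced elements with different first letters is cyclically
reduced. -/
theorem CycReduced.mul_of_gromov_eq_zero {a b : FreeGroup X} (ha : ¬ CycReduced a)
    (hb : ¬ CycReduced b) (hab : gromov a b = 0) : CycReduced (a * b) ∧ a * b ≠ 1 := by
  have ha' : 0 < gromov a a⁻¹ := Nat.pos_of_ne_zero ha
  have hb' : 0 < gromov b b⁻¹ := Nat.pos_of_ne_zero hb
  have pa : 0 < a.norm := by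
    rw [← gromov_self]
    exact gromov_pos_trans ha' (by rw [gromov_comm]; exact ha')
  have pb : 0 < b.norm := by
    rw [← gromov_self]
    exact gromov_pos_trans hb' (by rw [gromov_comm]; exact hb')
  have h1 : gromov a⁻¹ b = 0 := by
    by_contra hne
    have := gromov_pos_trans ha' (Nat.pos_of_ne_zero hne)
    omega
  have h2 := norm_mul a b
  have h3 := norm_inv_mul a (a * b)
  have h4 := norm_inv_mul b⁻¹ (a * b)⁻¹
  rw [inv_mul_cancel_left] at h3
  rw [show b⁻¹⁻¹ * (a * b)⁻¹ = a⁻¹ by group] at h4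
  simp only [FreeGroup.norm_inv_eq] at h4
  refine ⟨?_, fun h0 => ?_⟩
  · by_contra hne
    have h5 : 0 < gromov (a * b) (a * b)⁻¹ := Nat.pos_of_ne_zero hne
    have h6 := gromov_pos_trans (g := a) (by omega) h5
    have h7 : 0 < gromov (a * b)⁻¹ b := by
      refine gromov_pos_trans (h := b⁻¹) ?_ (by rw [gromov_comm]; exact hb')
      rw [gromov_comm]
      omega
    have := gromov_pos_trans h6 h7
    omega
  · rw [h0, FreeGroup.norm_one] at h2
    omega

/-- Away from the axes, all non-trivial elements of `H` point in one direction from `g`: if `h` and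
`k` pointed in different ones, the axis of `h * k` would pass through `g`. -/
theorem gromov_pos_of_not_onAxis {H : Subgroup (FreeGroup X)} {g : FreeGroup X}
    (hg : ¬ OnAxis H g) {h k : FreeGroup X} (hh : h ∈ H) (hk : k ∈ H) (h1 : h ≠ 1) (k1 : k ≠ 1) :
    0 < gromov (g⁻¹ * h * g) (g⁻¹ * k * g) := by
  by_contra h0
  have h2 := CycReduced.mul_of_gromov_eq_zero (fun hc => hg ⟨h, hh, h1, hc⟩)
    (fun hc => hg ⟨k, hk, k1, hc⟩) (Nat.eq_zero_of_not_pos h0)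
  have e : g⁻¹ * h * g * (g⁻¹ * k * g) = g⁻¹ * (h * k) * g := by group
  rw [e] at h2
  refine hg ⟨h * k, H.mul_mem hh hk, ?_, h2.1⟩
  intro h3
  rw [h3] at h2
  exact h2.2 (by group)

/-- Off the axes at most one edge leads towards them. Along any other edge the displacement of every
non-trivial element of `H` grows by two, while core edges bound it by `h₀.norm`. The induction is on
the room `k` left between the lower bound `l` and `h₀.norm`. -/
theorem isTrimmed_of_not_onAxis_aux {H : Subgroup (FreeGroup X)} {h₀ : FreeGroup X}
    (hh₀ : h₀ ∈ H) (h₀1 : h₀ ≠ 1) (k : ℕ) : ∀ (l : ℕ) (g : FreeGroup X), ¬ OnAxis H g →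
      (∀ h ∈ H, h ≠ 1 → l ≤ (g⁻¹ * h * g).norm) → ∀ x : (Gam H).V, RCoset.mk H g = x.1 →
      h₀.norm ≤ l + k → (Gam H).IsTrimmed x := by
  induction k using Nat.strong_induction_on with
  | _ k ih =>
    intro l g hg hl x hx hk
    have hconj : ∀ h : FreeGroup X, h ≠ 1 → g⁻¹ * h * g ≠ 1 := fun h h1 h0 => h1 (by
      have : h = g * (g⁻¹ * h * g) * g⁻¹ := by group
      rw [this, h0]; group)
    have away : ∀ e : (Gam H).E, (Gam H).ι e = x → gromov (letter e.1.2) (g⁻¹ * h₀ * g) = 0 →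
        (∀ h ∈ H, h ≠ 1 → ((g * letter e.1.2)⁻¹ * h * (g * letter e.1.2)).norm =
          (g⁻¹ * h * g).norm + 2) ∧ l + 2 ≤ h₀.norm := by
      rintro ⟨⟨c, y⟩, he⟩ hex hy
      have hc : c = RCoset.mk H g := (congrArg Subtype.val hex).trans hx.symm
      subst hc
      have hinv : ∀ h : FreeGroup X, g⁻¹ * h⁻¹ * g = (g⁻¹ * h * g)⁻¹ := fun h => by group
      have hz : ∀ h ∈ H, h ≠ 1 → ∀ w, 0 < gromov (letter y) w → gromov w (g⁻¹ * h * g) = 0 := by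
        intro h hh h1 w hw
        by_contra hne
        have h2 := gromov_pos_trans hw (Nat.pos_of_ne_zero hne)
        have h3 := gromov_pos_trans h2 (gromov_pos_of_not_onAxis hg hh hh₀ h1 h₀1)
        exact h3.ne' hy
      have hn : ∀ h ∈ H, h ≠ 1 → ∀ w, 0 < gromov (letter y) w →
          (w⁻¹ * (g⁻¹ * h * g) * w).norm = (g⁻¹ * h * g).norm + 2 * w.norm := by
        intro h hh h1 w hw
        refine norm_conj_of_gromov_eq_zero (hconj h h1) (hz h hh h1 w hw) ?_
        rw [← hinv]
        exact hz _ (H.inv_mem hh) (inv_ne_one.2 h1) w hw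
      constructor
      · intro h hh h1
        have h2 := hn h hh h1 (letter y) (by rw [gromov_self, norm_letter]; omega)
        rw [norm_letter] at h2
        rw [← h2]
        congr 1
        group
      · obtain ⟨h₁, hh₁, h₂, hh₂, hd⟩ := cover_isCoreEdge_iff.1 he
        have t1 := dist_triangle h₁ g h₂
        have t2 := dist_triangle g (g * letter y) h₂
        have t3 := dist_mul_letter g y
        have h3 := norm_inv_mul (letter y) (g⁻¹ * h₂)
        rw [norm_letter, show (letter y)⁻¹ * (g⁻¹ * h₂) = (g * letter y)⁻¹ * h₂ by group] at h3
        simp only [dist] at hd t1 t2 t3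
        -- This conjugate displaces the point `h₂` by exactly `|h₀|`. As `h₂` lies beyond the
        -- outward edge, its displacement at `g` is smaller by at least two.
        have hmem : h₂ * h₀ * h₂⁻¹ ∈ H := H.mul_mem (H.mul_mem hh₂ hh₀) (H.inv_mem hh₂)
        have hne : h₂ * h₀ * h₂⁻¹ ≠ 1 := by simpa using h₀1
        have h4 := hn _ hmem hne (g⁻¹ * h₂) (by omega)
        rw [show (g⁻¹ * h₂)⁻¹ * (g⁻¹ * (h₂ * h₀ * h₂⁻¹) * g) * (g⁻¹ * h₂) = h₀ by group] at h4
        have h5 := hl _ hmem hne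
        omega
    have trim : ∀ e : (Gam H).E, (Gam H).ι e = x → gromov (letter e.1.2) (g⁻¹ * h₀ * g) = 0 →
        (Gam H).IsTrimmed ((Gam H).τ e) := by
      intro e hex hy
      obtain ⟨h1, h2⟩ := away e hex hy
      refine ih (k - 2) (by omega) (l + 2) (g * letter e.1.2) ?_ (fun h hh hne => ?_) _ ?_ (by omega)
      · rintro ⟨h, hh, hne, hc⟩
        refine hg ⟨h, hh, hne, ?_⟩
        have h3 := hc.norm_le (letter e.1.2)⁻¹
        rw [h1 h hh hne, show (letter e.1.2)⁻¹⁻¹ *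
          ((g * letter e.1.2)⁻¹ * h * (g * letter e.1.2)) * (letter e.1.2)⁻¹ =
            g⁻¹ * h * g by group] at h3
        omega
      · rw [h1 h hh hne]
        have := hl h hh hne
        omega
      · have hc : e.1.1 = RCoset.mk H g := (congrArg Subtype.val hex).trans hx.symm
        show _ = e.1.1.smul (letter e.1.2)
        rw [hc]
        rfl
    -- If the edge towards the axes is present, it is the exceptional edge of the trimming step;
    -- otherwise all edges lead away and any of them serves.
    by_cases hc : ∃ e : (Gam H).E, (Gam H).ι e = x ∧ 0 < gromov (letter e.1.2) (g⁻¹ * h₀ * g)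
    · obtain ⟨e, rfl, he⟩ := hc
      refine Graph.IsTrimmed.intro e fun e' h' hne => trim e' h' ?_
      by_contra h0
      refine hne ((Gam H).folded _ _ h' (eq_of_gromov_letter_pos ?_))
      refine gromov_pos_trans (Nat.pos_of_ne_zero h0) ?_
      rw [gromov_comm]
      exact he
    · obtain ⟨e, rfl⟩ : ∃ e, (Gam H).ι e = x := by
        obtain ⟨e⟩ := Gam_nonempty hh₀ h₀1
        obtain ⟨p, hp⟩ := (Gam H).connected x ((Gam H).ι e)
        cases p with
        | nil => exact ⟨e, hp.symm⟩
        | cons e' p => exact ⟨e', hp.1⟩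
      refine Graph.IsTrimmed.intro e fun e' h' hne => trim e' h' ?_
      by_contra h0
      exact hc ⟨e', h', Nat.pos_of_ne_zero h0⟩

/-- The vertices of the core graph of `H ≠ 1` that survive trimming are those on the axes of the
non-trivial elements of `H`. -/
theorem not_isTrimmed_iff {H : Subgroup (FreeGroup X)} (hH : H ≠ ⊥) {x : (Gam H).V}
    {g : FreeGroup X} (hg : RCoset.mk H g = x.1) : ¬ (Gam H).IsTrimmed x ↔ OnAxis H g := by
  obtain ⟨h₀, h₀1⟩ := H.ne_bot_iff_exists_ne_one.1 hH
  refine ⟨fun h => ?_, fun h h' => not_onAxis_of_isTrimmed h' hg h⟩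
  by_contra h'
  exact h (isTrimmed_of_not_onAxis_aux h₀.2 (by simpa using h₀1) (h₀ : FreeGroup X).norm 0 g h'
    (fun _ _ _ => Nat.zero_le _) x hg (by omega))

end Trim

/-! ## Injectivity -/

theorem LHom.injective_of_onV {X : Type u} {Γ : LGraph.{u, v} X} {Δ : LGraph.{u, w} X}
    (f : LHom Γ Δ) (hΓ : Γ.IsFolded) (hf : Function.Injective f.onV) : f.Injective := by
  refine ⟨hf, fun e e' h => hΓ _ _ (hf ?_) ?_⟩
  · rw [← f.map_ι, ← f.map_ι, h]
  · rw [← f.map_label, ← f.map_label, h]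

theorem Trimf_isFolded {X : Type u} (Γ : CoreGraph.{u, v} X) : (Trimf Γ).IsFolded :=
  fun _ _ h h' => Subtype.ext (Γ.folded _ _ (congrArg Subtype.val h) h')

theorem RCoset.exists_mk {X : Type u} {H : Subgroup (FreeGroup X)} (c : RCoset H) :
    ∃ g, RCoset.mk H g = c := Quotient.exists_rep c

/-- For conjugate elements `s ≠ 1` and `t = k s k⁻¹`, the morphism of trimmed core graphs of
`⟨s⟩ ≤ ⟨s, t⟩` is injective. -/
theorem Trimf_map_injective {X : Type u} {s k : FreeGroup X} (hs : s ≠ 1)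
    {H K : Subgroup (FreeGroup X)} (hH : H = Subgroup.closure {s})
    (hK : K = Subgroup.closure {s, k * s * k⁻¹}) (hHK : H ≤ K) (hE : Nonempty (Gam H).E) :
    (Trimf.map (Gam.map hHK) hE).Injective := by
  classical
  refine LHom.injective_of_onV _ (Trimf_isFolded _) ?_
  have hH' : H = Subgroup.zpowers s := by rw [hH, Subgroup.zpowers_eq_closure]
  have hbot : H ≠ ⊥ := by
    rw [hH']
    simpa using hs
  -- All non-trivial powers of `s` have the same axis as `s`.
  have hax : ∀ g, OnAxis H g → CycReduced (g⁻¹ * s * g) := by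
    rintro g ⟨h, hh, h1, hc⟩
    rw [hH'] at hh
    obtain ⟨i, rfl⟩ := Subgroup.mem_zpowers_iff.1 hh
    refine CycReduced.of_zpow (k := i) (by rintro rfl; simp at h1) ?_
    convert hc using 1
    have : ∀ t, g⁻¹ * t * g = MulAut.conj g⁻¹ t := fun t => by simp
    rw [this, this, map_zpow]
  rintro ⟨⟨c, hc⟩, hct⟩ ⟨⟨c', hc'⟩, hct'⟩ h
  obtain ⟨g, rfl⟩ := RCoset.exists_mk c
  obtain ⟨g', rfl⟩ := RCoset.exists_mk c'
  have hg := hax g ((not_isTrimmed_iff hbot rfl).1 hct)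
  have hg' := hax g' ((not_isTrimmed_iff hbot rfl).1 hct')
  have h1 : RCoset.mk K g = RCoset.mk K g' := congrArg (fun t => t.1.1) h
  rw [RCoset.mk_eq] at h1
  have h2 : g' * g⁻¹ ∈ H := by
    -- This element of `K` carries the axis point `g` to the axis point `g'`. Conjugation by `g`
    -- puts the first of them at the base point.
    set y := g' * g⁻¹ with hy
    have hconj : ∀ t, g⁻¹ * t * g = MulAut.conj g⁻¹ t := fun t => by simp
    have h3 : g⁻¹ * y * g ∈ Subgroup.closure {g⁻¹ * s * g, g⁻¹ * (k * s * k⁻¹) * g} := by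
      have := Subgroup.mem_map_of_mem (MulAut.conj g⁻¹).toMonoidHom (hK ▸ h1)
      rw [MonoidHom.map_closure, Set.image_pair] at this
      simpa using this
    have h4 := mem_zpowers_of_cycReduced hg
      (by rw [hconj]; exact fun h => hs ((MulEquiv.map_eq_one_iff _).1 h))
      (k := g⁻¹ * k * g) (by group) h3 (by
        convert hg' using 1
        rw [hy]; group)
    obtain ⟨i, hi⟩ := Subgroup.mem_zpowers_iff.1 h4
    rw [hH']
    refine Subgroup.mem_zpowers_iff.2 ⟨i, ?_⟩
    rw [hconj, hconj, ← map_zpow] at hi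
    exact (MulAut.conj g⁻¹).injective hi
  exact Subtype.ext (Subtype.ext (RCoset.mk_eq.2 h2))

theorem map_K₀ {X : Type u} (ψ : Fab →* FreeGroup X) :
    K₀.map ψ = Subgroup.closure {ψ gB, ψ gA * ψ gB * (ψ gA)⁻¹} := by
  rw [K₀, MonoidHom.map_closure, Set.image_pair, map_mul, map_mul, map_inv]

theorem map_H₀ {X : Type u} (ψ : Fab →* FreeGroup X) :
    H₀.map ψ = Subgroup.closure {ψ gB} := by
  rw [H₀, MonoidHom.map_closure, Set.image_singleton]

theorem extMor_injective {Y : Type u} (ψ : Fab →* FreeGroup Y) (hψ : Function.Injective ψ) :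
    (extMor ψ hψ).Injective :=
  Trimf_map_injective (fun h => FreeGroup.of_ne_one AB.b (hψ (h.trans (map_one ψ).symm)))
    (map_H₀ ψ) (map_K₀ ψ) _ _

/-! ## The fundamental group of `𝓕_φ(Δ)` -/

/-- `ReachF φ Δ x t`: there is a path in `Δ` which, followed by a part of a subdivided edge if
necessary, gives a path from the base point to `x` in `𝓕_φ(Δ)` with label `t`. -/
def ReachF {X : Type u} {Y : Type w} (φ : FreeGroup Y →* FreeGroup X) (Δ : PGraph.{w, v} Y) :
    FV φ Δ.toLGraph → FreeGroup X → Prop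
  | Sum.inl x, t => ∃ p, Δ.IsPath p Δ.base x ∧ φ (Δ.pathLabel p) = t
  | Sum.inr s, t => ∃ p, Δ.IsPath p Δ.base (Δ.ι s.1.1) ∧
      φ (Δ.pathLabel p) * FreeGroup.mk ((edgeWord φ Δ.toLGraph s.1.1).take s.1.2) = t

theorem mk_edgeWord {X : Type u} {Y : Type w} (φ : FreeGroup Y →* FreeGroup X)
    (Δ : LGraph.{w, v} Y) (e : Δ.E) (he : (Δ.label e).2 = true) :
    FreeGroup.mk (edgeWord φ Δ e) = φ (letter (Δ.label e)) := by
  have h : letter (Δ.label e) = FreeGroup.of (Δ.label e).1 := by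
    rw [letter, FreeGroup.of, ← he]
  rw [h]
  exact @FreeGroup.mk_toWord X (Classical.decEq X) _

/-- Interior vertices and both ends get one description. At the far end, a path in `Δ` to the
terminal vertex of `e` becomes one to its initial vertex by appending `Δ.bar e`, and the two labels
cancel. -/
theorem reachF_pathVertex {X : Type u} {Y : Type w} (φ : FreeGroup Y →* FreeGroup X)
    (Δ : PGraph.{w, v} Y) (e : Δ.E) (he : (Δ.label e).2 = true) {k : ℕ}
    (hk : k ≤ (edgeWord φ Δ.toLGraph e).length) (t : FreeGroup X) :
    ReachF φ Δ (pathVertex φ Δ.toLGraph e he k) t ↔ ∃ p, Δ.IsPath p Δ.base (Δ.ι e) ∧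
      φ (Δ.pathLabel p) * FreeGroup.mk ((edgeWord φ Δ.toLGraph e).take k) = t := by
  unfold pathVertex
  split_ifs with h1 h2
  · rfl
  · subst h2
    simp only [ReachF, List.take_zero, ← FreeGroup.one_eq_mk, mul_one]
  · have hk' : k = (edgeWord φ Δ.toLGraph e).length := by omega
    subst hk'
    simp only [ReachF, List.take_length, mk_edgeWord φ Δ.toLGraph e he]
    have happ : ∀ (p : List Δ.E) (f : Δ.E), Δ.pathLabel (p ++ [f]) =
        Δ.pathLabel p * letter (Δ.label f) := fun p f => by
      simp [LGraph.pathLabel, letter, FreeGroup.mul_mk]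
    constructor
    · rintro ⟨p, hp, rfl⟩
      refine ⟨p ++ [Δ.bar e], Graph.isPath_append hp ⟨rfl, ?_⟩, ?_⟩
      · rw [Graph.τ, Δ.bar_bar]; rfl
      · rw [happ, map_mul, Δ.label_bar, mul_assoc, ← map_mul]
        have := letter_mul_inv (inv (Δ.label e))
        rw [show inv (inv (Δ.label e)) = Δ.label e by simp [inv]] at this
        rw [this, map_one, mul_one]
    · rintro ⟨p, hp, rfl⟩
      exact ⟨p ++ [e], Graph.isPath_append hp ⟨rfl, rfl⟩, by rw [happ, map_mul]⟩

theorem ReachF.step {X : Type u} {Y : Type w} {φ : FreeGroup Y →* FreeGroup X}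
    {Δ : PGraph.{w, v} Y} (f : (F φ Δ.toLGraph).E) {t : FreeGroup X}
    (h : ReachF φ Δ ((F φ Δ.toLGraph).ι f) t) :
    ReachF φ Δ ((F φ Δ.toLGraph).τ f) (t * letter ((F φ Δ.toLGraph).label f)) := by
  obtain ⟨⟨e, k, b⟩, he, hk⟩ := f
  have hk' : k < (edgeWord φ Δ.toLGraph e).length := hk
  have htake : FreeGroup.mk ((edgeWord φ Δ.toLGraph e).take (k + 1)) =
      FreeGroup.mk ((edgeWord φ Δ.toLGraph e).take k) *
        letter ((edgeWord φ Δ.toLGraph e)[k]'hk') := by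
    rw [letter, FreeGroup.mul_mk, List.take_add_one, List.getElem?_eq_getElem hk']
    rfl
  cases b with
  | true =>
    have h' : ReachF φ Δ (pathVertex φ Δ.toLGraph e he k) t := h
    show ReachF φ Δ (pathVertex φ Δ.toLGraph e he (k + 1))
      (t * letter ((edgeWord φ Δ.toLGraph e)[k]'hk'))
    rw [reachF_pathVertex φ Δ e he (by omega)] at h' ⊢
    obtain ⟨p, hp, rfl⟩ := h'
    exact ⟨p, hp, by rw [htake, mul_assoc]⟩
  | false =>
    have h' : ReachF φ Δ (pathVertex φ Δ.toLGraph e he (k + 1)) t := h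
    show ReachF φ Δ (pathVertex φ Δ.toLGraph e he k)
      (t * letter (inv ((edgeWord φ Δ.toLGraph e)[k]'hk')))
    rw [reachF_pathVertex φ Δ e he (by omega)] at h' ⊢
    obtain ⟨p, hp, rfl⟩ := h'
    exact ⟨p, hp, by rw [htake, mul_assoc, mul_assoc, letter_mul_inv, mul_one]⟩

/-- The relation `ReachF` propagates along every edge, so any path in `𝓕_φ(Δ)` from the base point,
backtracking inside subdivided edges included, has the label of a path that comes from `Δ`. -/
theorem π₁_PF {X : Type u} {Y : Type w} {φ : FreeGroup Y →* FreeGroup X} (hφ : NonDegenerate φ)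
    (Δ : PGraph.{w, v} Y) : (PF φ Δ).π₁ = Δ.π₁.map φ := by
  refine le_antisymm ?_ (le_π₁_PF hφ Δ)
  have key : ∀ (q : List (F φ Δ.toLGraph).E) (x y : (F φ Δ.toLGraph).V) (t : FreeGroup X),
      (F φ Δ.toLGraph).IsPath q x y → ReachF φ Δ x t →
      ReachF φ Δ y (t * (F φ Δ.toLGraph).pathLabel q) := by
    intro q
    induction q with
    | nil =>
      rintro x y t h hx
      have hxy : x = y := h
      subst hxy
      have : (F φ Δ.toLGraph).pathLabel [] = 1 := rfl
      rwa [this, mul_one]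
    | cons f q ih =>
      rintro x y t ⟨rfl, h⟩ hx
      have := ih _ _ _ h hx.step
      rw [mul_assoc] at this
      exact this
  rintro _ ⟨q, hq, rfl⟩
  have h := key q _ _ 1 hq ⟨[], rfl, map_one φ⟩
  rw [one_mul] at h
  obtain ⟨p, hp, hpq⟩ := h
  exact ⟨_, ⟨p, hp, rfl⟩, hpq⟩

theorem unpointedMor_injective {X : Type u} (φ : Fab →* FreeGroup X) (hφ : NonDegenerate φ) :
    (unpointedMor φ hφ).Injective := by
  refine Trimf_map_injective (s := φ gB) (k := φ gA) (hφ AB.b) ?_ ?_ _ _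
  · rw [π₁_PF hφ, ← map_H₀]
    exact congrArg (Subgroup.map φ) (π₁_Gam H₀)
  · rw [π₁_PF hφ, ← map_K₀]
    exact congrArg (Subgroup.map φ) (π₁_Gam K₀)

/-! ## Change of the base point -/

section Conj

variable {X : Type u}

theorem LHom.bijective_of_inverse {Γ : LGraph.{u, v} X} {Δ : LGraph.{u, w} X} {f : LHom Γ Δ}
    {g : LHom Δ Γ} (hV : ∀ x, g.onV (f.onV x) = x) (hE : ∀ e, g.onE (f.onE e) = e)
    (hV' : ∀ x, f.onV (g.onV x) = x) (hE' : ∀ e, f.onE (g.onE e) = e) : f.Bijective :=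
  ⟨⟨Function.LeftInverse.injective hV, Function.RightInverse.surjective hV'⟩,
    ⟨Function.LeftInverse.injective hE, Function.RightInverse.surjective hE'⟩⟩

/-- The map `H g ↦ H' w g` of cosets, if `w H w⁻¹ ≤ H'`. -/
def RCoset.shift {H H' : Subgroup (FreeGroup X)} (w : FreeGroup X)
    (hw : ∀ h ∈ H, w * h * w⁻¹ ∈ H') : RCoset H → RCoset H' :=
  Quotient.map' (fun g => w * g) fun a b hab => by
    rw [QuotientGroup.rightRel_apply] at hab ⊢
    have := hw _ hab
    rwa [show w * b * (w * a)⁻¹ = w * (b * a⁻¹) * w⁻¹ by group]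

theorem RCoset.shift_mk {H H' : Subgroup (FreeGroup X)} {w : FreeGroup X}
    (hw : ∀ h ∈ H, w * h * w⁻¹ ∈ H') (g : FreeGroup X) :
    (RCoset.mk H g).shift w hw = RCoset.mk H' (w * g) := rfl

theorem RCoset.shift_smul {H H' : Subgroup (FreeGroup X)} {w : FreeGroup X}
    (hw : ∀ h ∈ H, w * h * w⁻¹ ∈ H') (c : RCoset H) (s : FreeGroup X) :
    (c.smul s).shift w hw = (c.shift w hw).smul s := by
  obtain ⟨g, rfl⟩ := RCoset.exists_mk c
  exact congrArg (RCoset.mk H') (mul_assoc w g s).symm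

theorem RCoset.shift_shift {H H' : Subgroup (FreeGroup X)} {w w' : FreeGroup X}
    (hw : ∀ h ∈ H, w * h * w⁻¹ ∈ H') (hw' : ∀ h ∈ H', w' * h * w'⁻¹ ∈ H) (h1 : w' * w = 1)
    (c : RCoset H) : (c.shift w hw).shift w' hw' = c := by
  obtain ⟨g, rfl⟩ := RCoset.exists_mk c
  rw [RCoset.shift_mk, RCoset.shift_mk, ← mul_assoc, h1, one_mul]

variable [DecidableEq X]

/-- The cosets `H g` with `g` on the axis of a non-trivial element of `H`. -/
def RCoset.OnAxis {H : Subgroup (FreeGroup X)} (c : RCoset H) : Prop :=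
  ∃ g, RCoset.mk H g = c ∧ CoreGraphs.OnAxis H g

theorem RCoset.OnAxis.isCoreVertex {H : Subgroup (FreeGroup X)} {c : RCoset H} (h : c.OnAxis) :
    (cover H).IsCoreVertex c := by
  obtain ⟨g, rfl, hg⟩ := h
  exact cover_isCoreVertex_iff.2 hg.inHull

theorem RCoset.OnAxis.isCoreEdge {H : Subgroup (FreeGroup X)} {c : RCoset H} {x : X × Bool}
    (h : c.OnAxis) (h' : (c.smul (letter x)).OnAxis) : (cover H).IsCoreEdge (c, x) := by
  obtain ⟨g, rfl, hg⟩ := h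
  obtain ⟨g', hg', h''⟩ := h'
  exact cover_isCoreEdge_of_inHull hg.inHull (h''.congr hg').inHull

theorem not_isTrimmed_iff_onAxis {H : Subgroup (FreeGroup X)} (hH : H ≠ ⊥) (x : (Gam H).V) :
    ¬ (Gam H).IsTrimmed x ↔ RCoset.OnAxis x.1 := by
  obtain ⟨g, hg⟩ := RCoset.exists_mk x.1
  rw [not_isTrimmed_iff hH hg]
  refine ⟨fun h => ⟨g, hg, h⟩, ?_⟩
  rintro ⟨g', hg', h⟩
  exact h.congr (hg'.trans hg.symm)

theorem RCoset.OnAxis.shift {H H' : Subgroup (FreeGroup X)} {w : FreeGroup X}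
    (hw : ∀ h ∈ H, w * h * w⁻¹ ∈ H') {c : RCoset H} (hc : c.OnAxis) :
    (c.shift w hw).OnAxis := by
  obtain ⟨g, rfl, h, hh, h1, hg⟩ := hc
  refine ⟨w * g, rfl, w * h * w⁻¹, hw h hh, by simpa using h1, ?_⟩
  rwa [show (w * g)⁻¹ * (w * h * w⁻¹) * (w * g) = g⁻¹ * h * g by group]

/-- The morphism of trimmed core graphs `H g ↦ H' w g`, if `w H w⁻¹ ≤ H'`. -/
def Trimf.shift {H H' : Subgroup (FreeGroup X)} (hH : H ≠ ⊥) (hH' : H' ≠ ⊥) (w : FreeGroup X)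
    (hw : ∀ h ∈ H, w * h * w⁻¹ ∈ H') : LHom (Trimf (Gam H)) (Trimf (Gam H')) :=
  have hV (x : (Gam H).V) (hx : ¬ (Gam H).IsTrimmed x) : (RCoset.shift w hw x.1).OnAxis :=
    ((not_isTrimmed_iff_onAxis hH x).1 hx).shift hw
  have hE (e : (Trimf (Gam H)).E) :
      ((RCoset.shift w hw e.1.1.1).smul (letter e.1.1.2)).OnAxis := by
    rw [← RCoset.shift_smul hw]
    exact hV _ e.2.2
  { onV := fun x => ⟨⟨RCoset.shift w hw x.1.1, (hV x.1 x.2).isCoreVertex⟩,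
      (not_isTrimmed_iff_onAxis hH' _).2 (hV x.1 x.2)⟩
    onE := fun e => ⟨⟨(RCoset.shift w hw e.1.1.1, e.1.1.2), (hV _ e.2.1).isCoreEdge (hE e)⟩,
      (not_isTrimmed_iff_onAxis hH' _).2 (hV _ e.2.1), (not_isTrimmed_iff_onAxis hH' _).2 (hE e)⟩
    map_ι := fun _ => rfl
    map_bar := fun e => Subtype.ext (Subtype.ext (Prod.ext (RCoset.shift_smul hw _ _) rfl))
    map_label := fun _ => rfl }

theorem Trimf.shift_bijective {H H' : Subgroup (FreeGroup X)} (hH : H ≠ ⊥) (hH' : H' ≠ ⊥)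
    (w : FreeGroup X) (hw : ∀ h ∈ H, w * h * w⁻¹ ∈ H') (hw' : ∀ h ∈ H', w⁻¹ * h * w⁻¹⁻¹ ∈ H) :
    (Trimf.shift hH hH' w hw).Bijective := by
  have h1 := RCoset.shift_shift hw hw' (inv_mul_cancel w)
  have h2 := RCoset.shift_shift hw' hw (mul_inv_cancel w)
  exact LHom.bijective_of_inverse (g := Trimf.shift hH' hH w⁻¹ hw')
    (fun x => Subtype.ext (Subtype.ext (h1 _)))
    (fun e => Subtype.ext (Subtype.ext (Prod.ext (h1 _) rfl)))
    (fun x => Subtype.ext (Subtype.ext (h2 _)))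
    (fun e => Subtype.ext (Subtype.ext (Prod.ext (h2 _) rfl)))

end Conj

/-- Conjugate extensions of subgroups give isomorphic morphisms of trimmed core graphs. -/
theorem Trimf_map_isIsomorphic {X : Type u} {H K H' K' : Subgroup (FreeGroup X)} (hHK : H ≤ K)
    (hHK' : H' ≤ K') (hE : Nonempty (Gam H).E) (hE' : Nonempty (Gam H').E) (hH : H ≠ ⊥)
    (w : FreeGroup X) (h1 : H' = H.map (MulAut.conj w).toMonoidHom)
    (h2 : K' = K.map (MulAut.conj w).toMonoidHom) :
    (Trimf.map (Gam.map hHK) hE).IsIsomorphic (Trimf.map (Gam.map hHK') hE') := by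
  classical
  have key : ∀ {L L' : Subgroup (FreeGroup X)}, L' = L.map (MulAut.conj w).toMonoidHom → L ≠ ⊥ →
      L' ≠ ⊥ ∧ (∀ h ∈ L, w * h * w⁻¹ ∈ L') ∧ ∀ h ∈ L', w⁻¹ * h * w⁻¹⁻¹ ∈ L := by
    rintro L _ rfl hL
    refine ⟨?_, fun h hh => ⟨h, hh, rfl⟩, ?_⟩
    · rwa [Ne, Subgroup.map_eq_bot_iff_of_injective _ (MulAut.conj w).injective]
    · rintro _ ⟨h, hh, rfl⟩
      have : w⁻¹ * (MulAut.conj w).toMonoidHom h * w⁻¹⁻¹ = h := by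
        simp [mul_assoc]
      rwa [this]
  have hK : K ≠ ⊥ := fun h => hH (le_bot_iff.1 (h ▸ hHK))
  obtain ⟨hH', hw, hw'⟩ := key h1 hH
  obtain ⟨hK', hv, hv'⟩ := key h2 hK
  refine ⟨Trimf.shift hH hH' w hw, Trimf.shift hK hK' w hv, Trimf.shift_bijective hH hH' w hw hw',
    Trimf.shift_bijective hK hK' w hv hv', ?_⟩
  -- Both composites send `H g` to `K' w g`.
  refine LHom.ext (funext fun x => Subtype.ext (Subtype.ext ?_))
    (funext fun e => Subtype.ext (Subtype.ext (Prod.ext ?_ rfl)))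
  · obtain ⟨⟨c, hc⟩, hx⟩ := x
    obtain ⟨g, rfl⟩ := RCoset.exists_mk c
    rfl
  · obtain ⟨⟨⟨c, y⟩, hc⟩, hx⟩ := e
    obtain ⟨g, rfl⟩ := RCoset.exists_mk c
    rfl

/-- Two representatives differ by an inner automorphism, and `θ ∘ conj g = conj (θ g) ∘ θ` moves it
to the target, where it conjugates both subgroups by `θ g`. -/
theorem extMor_isIsomorphic {θ θ' : MulAut Fab}
    (h : (QuotientGroup.mk θ : Out Fab) = QuotientGroup.mk θ') :
    (extMor θ.toMonoidHom θ.injective).IsIsomorphic (extMor θ'.toMonoidHom θ'.injective) := by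
  obtain ⟨g, hg⟩ := QuotientGroup.eq.1 h
  have hθ : θ'.toMonoidHom = (MulAut.conj (θ g)).toMonoidHom.comp θ.toMonoidHom := by
    have h1 : θ' = θ * MulAut.conj g := by rw [hg, mul_inv_cancel_left]
    ext t
    simp [h1]
  refine Trimf_map_isIsomorphic _ _ _ _ ?_ (θ g) ?_ ?_
  · intro h0
    have h1 : θ gB ∈ H₀.map θ.toMonoidHom := Subgroup.mem_map_of_mem _ gB_mem
    rw [h0, Subgroup.mem_bot, MulEquiv.map_eq_one_iff] at h1
    exact FreeGroup.of_ne_one AB.b h1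
  · rw [Subgroup.map_map, hθ]
  · rw [Subgroup.map_map, hθ]

end CoreGraphs

theorem theorem4p2 :
    -- all morphisms `Trimf ∘ Core ∘ 𝓕_φ (Γ → Δ)` are injective
    (∀ (X : Type u) [Countable X] [Infinite X] (φ : CoreGraphs.Fab →* FreeGroup X)
      (hφ : CoreGraphs.NonDegenerate φ), (CoreGraphs.unpointedMor φ hφ).Injective) ∧
    -- every outer automorphism of `F_{a,b}` determines, up to isomorphism of morphisms, a morphism of
    -- unpointed core graphs, and it is injective
    (∀ o : CoreGraphs.Out CoreGraphs.Fab,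
      (∀ θ θ' : MulAut CoreGraphs.Fab, QuotientGroup.mk θ = o → QuotientGroup.mk θ' = o →
        (CoreGraphs.extMor θ.toMonoidHom θ.injective).IsIsomorphic
          (CoreGraphs.extMor θ'.toMonoidHom θ'.injective)) ∧
      (∀ θ : MulAut CoreGraphs.Fab, QuotientGroup.mk θ = o →
        (CoreGraphs.extMor θ.toMonoidHom θ.injective).Injective)) ∧
    -- the same under automorphisms of every free group containing `F_{a,b}`
    (∀ (Y : Type v) (j : CoreGraphs.Fab →* FreeGroup Y) (hj : Function.Injective j)
      (θ : MulAut (FreeGroup Y)),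
      (CoreGraphs.extMor (θ.toMonoidHom.comp j) (θ.injective.comp hj)).Injective) :=
  ⟨fun _ _ _ φ hφ => CoreGraphs.unpointedMor_injective φ hφ,
    fun _ => ⟨fun _ _ h h' => CoreGraphs.extMor_isIsomorphic (h.trans h'.symm),
      fun _ _ => CoreGraphs.extMor_injective _ _⟩,
    fun _ _ _ _ => CoreGraphs.extMor_injective _ _⟩
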